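/- Let $(M^n,g,J)$ be a closed (compact, without boundary), connected, smooth almost Hermitian manifold of real dimension $n\ge 6$: $g$ is a smooth Riemannian metric and $J$ a smooth almost complex structure ($J^2=-1$) with $g(JX,JY)=g(X,Y)$. Let $\nabla$ be the Levi-Civita connection and $R(X,Y)Z=\nabla_{[X,Y]}Z-[\nabla_X,\nabla_Y]Z$. Put $$\operatorname{Ric}(X,Y)=\operatorname{tr}\{Z\mapsto R(X,Z)Y\},\qquad \operatorname{Ric}^*(X,Y)=\operatorname{tr}\{Z\mapsto -J(R(X,Z)(JY))\},$$ and let $S_J=\operatorname{tr}_g\operatorname{Ric}-\operatorname{tr}_g\operatorname{Ric}^*$ be the holomorphic d-scalar curvature. With $p=\frac{2n}{n-2}$, set $$Y(M,g,J)=\inf\left\{\frac{\int_M \widetilde{S_J}\,dV_{\widetilde g}}{\left(\int_M dV_{\widetilde g}\right)^{2/p}} \;:\; u\in C^\infty(M),\ u>0,\ \widetilde g=u^{p-2}g\right\},$$ where $\widetilde{S_J}$ is the holomorphic d-scalar curvature of $(M,\widetilde g,J)$. If $Y(M,g,J)<0$, then $J$ is not integrable, i.e. $J$ is not induced by a complex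 manifold structure on $M$: it is not the case that around every point there are local coordinates with values in some $\mathbb{C}^m$ in which $J$ is multiplication by $i$. -/

import Mathlib

open scoped Manifold ContDiff
open MeasureTheory

noncomputable section

namespace AlmostHermitian

section Basic

variable (n : ℕ) (M : Type*) [TopologicalSpace M] [ChartedSpace (EuclideanSpace ℝ (Fin n)) M]
  [IsManifold (𝓡 n) ∞ M]

/-- Smooth Riemannian metrics on the smooth `n`-manifold `M`. -/
abbrev RiemannianMetric : Type _ :=
  Bundle.ContMDiffRiemannianMetric (𝓡 n) ∞ (EuclideanSpace ℝ (Fin n))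
    (fun x : M => TangentSpace (𝓡 n) x)

/-- A smooth almost complex structure on `M`: a smooth field of endomorphisms of the tangent
spaces with square `-1`. -/
structure AlmostComplexStructure where
  /-- The endomorphism of each tangent space. -/
  toFun (x : M) : TangentSpace (𝓡 n) x →L[ℝ] TangentSpace (𝓡 n) x
  sq_eq_neg (x : M) (v : TangentSpace (𝓡 n) x) : toFun x (toFun x v) = -v
  contMDiff : ContMDiff (𝓡 n)
    ((𝓡 n).prod 𝓘(ℝ, EuclideanSpace ℝ (Fin n) →L[ℝ] EuclideanSpace ℝ (Fin n))) ∞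
    (fun x => Bundle.TotalSpace.mk' (EuclideanSpace ℝ (Fin n) →L[ℝ] EuclideanSpace ℝ (Fin n))
      (E := fun x : M => TangentSpace (𝓡 n) x →L[ℝ] TangentSpace (𝓡 n) x) x (toFun x))

end Basic

variable {n : ℕ} {M : Type*} [TopologicalSpace M] [ChartedSpace (EuclideanSpace ℝ (Fin n)) M]
  [IsManifold (𝓡 n) ∞ M]

/-- The metric `g` and the almost complex structure `J` are compatible, that is, `(M, g, J)` is an
almost Hermitian manifold: `g(JX, JY) = g(X, Y)`. -/
def IsCompatible (g : RiemannianMetric n M) (J : AlmostComplexStructure n M) : Prop :=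
  ∀ (x : M) (v w : TangentSpace (𝓡 n) x), g.inner x (J.toFun x v) (J.toFun x w) = g.inner x v w

/-- `J` is integrable: around every point there are holomorphic coordinates, i.e. a smooth
diffeomorphism `φ` from a neighbourhood onto an open subset of `ℂ ^ m` with `dφ ∘ J = i dφ`.
(Transition maps between such coordinates are then holomorphic, so that they form the atlas of a
complex manifold inducing `J`.) -/
def AlmostComplexStructure.IsIntegrable (J : AlmostComplexStructure n M) : Prop :=
  ∀ x : M, ∃ (m : ℕ) (φ : OpenPartialHomeomorph M (Fin m → ℂ)),
    x ∈ φ.source ∧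
    ContMDiffOn (𝓡 n) 𝓘(ℝ, Fin m → ℂ) ∞ φ φ.source ∧
    ContMDiffOn 𝓘(ℝ, Fin m → ℂ) (𝓡 n) ∞ φ.symm φ.target ∧
    ∀ p ∈ φ.source, ∀ v : TangentSpace (𝓡 n) p,
      let dφ : TangentSpace (𝓡 n) p →L[ℝ] (Fin m → ℂ) := mfderiv (𝓡 n) 𝓘(ℝ, Fin m → ℂ) φ p
      dφ (J.toFun p v) = Complex.I • dφ v

/-! ### Curvature in local coordinates -/

/-- Partial derivative in the `i`-th coordinate direction. -/
def pderiv (i : Fin n) (f : EuclideanSpace ℝ (Fin n) → ℝ) (y : EuclideanSpace ℝ (Fin n)) : ℝ :=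
  fderiv ℝ f y (EuclideanSpace.single i 1)

/-- The coordinate vector field `∂ᵢ` of the preferred chart at `x₀`, at the point with
coordinates `y`. -/
def coordVec (x₀ : M) (y : EuclideanSpace ℝ (Fin n)) (i : Fin n) :
    TangentSpace (𝓡 n) ((extChartAt (𝓡 n) x₀).symm y) :=
  mfderiv 𝓘(ℝ, EuclideanSpace ℝ (Fin n)) (𝓡 n) (extChartAt (𝓡 n) x₀).symm y
    (EuclideanSpace.single i (1 : ℝ) : EuclideanSpace ℝ (Fin n))

/-- The coefficients `g_{ij} = g(∂ᵢ, ∂ⱼ)` of the metric in the preferred chart at `x₀`. -/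
def gram (g : RiemannianMetric n M) (x₀ : M) (y : EuclideanSpace ℝ (Fin n)) :
    Matrix (Fin n) (Fin n) ℝ :=
  Matrix.of fun i j =>
    g.inner ((extChartAt (𝓡 n) x₀).symm y) (coordVec x₀ y i) (coordVec x₀ y j)

/-- The coefficients `J^i_j` of the almost complex structure in the preferred chart at `x₀`:
`J ∂ⱼ = ∑ i, J^i_j ∂ᵢ`. -/
def jMatrix (J : AlmostComplexStructure n M) (x₀ : M) (y : EuclideanSpace ℝ (Fin n)) :
    Matrix (Fin n) (Fin n) ℝ :=
  Matrix.of fun i j =>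
    let w : EuclideanSpace ℝ (Fin n) :=
      mfderiv (𝓡 n) 𝓘(ℝ, EuclideanSpace ℝ (Fin n)) (extChartAt (𝓡 n) x₀)
        ((extChartAt (𝓡 n) x₀).symm y) (J.toFun _ (coordVec x₀ y j))
    w i

/-- Christoffel symbols of the Levi-Civita connection, `∇_{∂ᵢ} ∂ⱼ = ∑ k, Γ^k_{ij} ∂ₖ`, for a matrix
of metric coefficients `G`:
`Γ^k_{ij} = ½ ∑ l, G^{kl} (∂ᵢ G_{jl} + ∂ⱼ G_{il} - ∂ₗ G_{ij})`. -/
def christoffel (G : EuclideanSpace ℝ (Fin n) → Matrix (Fin n) (Fin n) ℝ)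
    (k i j : Fin n) (y : EuclideanSpace ℝ (Fin n)) : ℝ :=
  (1 / 2 : ℝ) * ∑ l, (G y)⁻¹ k l *
    (pderiv i (fun z => G z j l) y + pderiv j (fun z => G z i l) y
      - pderiv l (fun z => G z i j) y)

/-- Components of the curvature `R(X, Y)Z = ∇_{[X, Y]} Z - ∇_X ∇_Y Z + ∇_Y ∇_X Z` of the
Levi-Civita connection: `R(∂ᵢ, ∂ⱼ)∂ₖ = ∑ l, R^l_{ijk} ∂ₗ`. -/
def curv (G : EuclideanSpace ℝ (Fin n) → Matrix (Fin n) (Fin n) ℝ)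
    (l i j k : Fin n) (y : EuclideanSpace ℝ (Fin n)) : ℝ :=
  -(pderiv i (christoffel G l j k) y - pderiv j (christoffel G l i k) y
    + ∑ m, (christoffel G l i m y * christoffel G m j k y
      - christoffel G l j m y * christoffel G m i k y))

/-- Ricci tensor `Ric(X, Y) = tr {Z ↦ R(X, Z)Y}`, component `Ric(∂ᵢ, ∂ₖ)`. -/
def ricci (G : EuclideanSpace ℝ (Fin n) → Matrix (Fin n) (Fin n) ℝ)
    (i k : Fin n) (y : EuclideanSpace ℝ (Fin n)) : ℝ :=
  ∑ j, curv G j i j k y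

/-- `*`-Ricci tensor `Ric*(X, Y) = tr {Z ↦ -J(R(X, Z)(JY))}`, component `Ric*(∂ᵢ, ∂ₖ)`, where `A` is
the matrix of `J`. -/
def starRicci (G : EuclideanSpace ℝ (Fin n) → Matrix (Fin n) (Fin n) ℝ)
    (A : Matrix (Fin n) (Fin n) ℝ) (i k : Fin n) (y : EuclideanSpace ℝ (Fin n)) : ℝ :=
  ∑ j, -∑ l, A j l * ∑ m, A m k * curv G l i j m y

/-- The scalar curvature `R_g = tr_g Ric`; its value at `x` is computed in the preferred chart
at `x`. -/
def scalarCurvature (g : RiemannianMetric n M) (x : M) : ℝ :=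
  ∑ i, ∑ k, (gram g x (extChartAt (𝓡 n) x x))⁻¹ i k *
    ricci (gram g x) i k (extChartAt (𝓡 n) x x)

/-- The `*`-scalar curvature `R*_g = tr_g Ric*`; its value at `x` is computed in the preferred chart
at `x`. -/
def starScalarCurvature (g : RiemannianMetric n M) (J : AlmostComplexStructure n M) (x : M) : ℝ :=
  ∑ i, ∑ k, (gram g x (extChartAt (𝓡 n) x x))⁻¹ i k *
    starRicci (gram g x) (jMatrix J x (extChartAt (𝓡 n) x x)) i k (extChartAt (𝓡 n) x x)

/-- The holomorphic d-scalar curvature `S_J = R_g - R*_g`. -/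
def holoScalarCurvature (g : RiemannianMetric n M) (J : AlmostComplexStructure n M) (x : M) : ℝ :=
  scalarCurvature g x - starScalarCurvature g J x

/-! ### Riemannian volume -/

/-- The Riemannian volume of the domain of the preferred chart at `x₀`, extended by zero to `M`: in
coordinates it is `√(det g_{ij})` times Lebesgue measure. -/
def chartVolume [MeasurableSpace M] (g : RiemannianMetric n M) (x₀ : M) : Measure M :=
  (((volume : Measure (EuclideanSpace ℝ (Fin n))).restrict (extChartAt (𝓡 n) x₀).target).withDensity
    (fun y => ENNReal.ofReal (Real.sqrt (gram g x₀ y).det))).map (extChartAt (𝓡 n) x₀).symm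

/-- The Riemannian volume measure `dV_g`. The measures `chartVolume g x₀` are its restrictions to
the chart domains, and it is their supremum in the complete lattice of measures (on a second
countable manifold, a measure is the supremum of its restrictions to the sets of an open cover). -/
def volumeMeasure [MeasurableSpace M] (g : RiemannianMetric n M) : Measure M :=
  ⨆ x₀ : M, chartVolume g x₀

/-! ### Conformal change and the conformal invariant -/

/-- The conformal metric `f g` for a positive smooth function `f`. -/
def conformal (g : RiemannianMetric n M) (f : M → ℝ) (hf : ContMDiff (𝓡 n) 𝓘(ℝ) ∞ f)
    (hpos : ∀ x, 0 < f x) : RiemannianMetric n M where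
  inner x := f x • g.inner x
  symm x v w := by
    change f x * g.inner x v w = f x * g.inner x w v
    rw [g.symm]
  pos x v hv := mul_pos (hpos x) (g.pos x v hv)
  isVonNBounded x := by
    have h := (g.isVonNBounded x).image
      ((Real.sqrt (f x))⁻¹ • ContinuousLinearMap.id ℝ (TangentSpace (𝓡 n) x))
    refine h.subset ?_
    intro v hv
    have h0 : 0 < Real.sqrt (f x) := Real.sqrt_pos.2 (hpos x)
    refine ⟨Real.sqrt (f x) • v, ?_, ?_⟩
    · have hv' : f x * g.inner x v v < 1 := hv
      change g.inner x (Real.sqrt (f x) • v) (Real.sqrt (f x) • v) < 1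
      rw [map_smul, map_smul, _root_.smul_apply, smul_smul, Real.mul_self_sqrt
        (hpos x).le]
      exact hv'
    · change (Real.sqrt (f x))⁻¹ • (Real.sqrt (f x) • v) = v
      rw [smul_smul, inv_mul_cancel₀ h0.ne', one_smul]
  contMDiff := hf.smul_section g.contMDiff

/-- Positive smooth functions on `M`. -/
structure PosSmooth (n : ℕ) (M : Type*) [TopologicalSpace M]
    [ChartedSpace (EuclideanSpace ℝ (Fin n)) M] where
  /-- The underlying function. -/
  toFun : M → ℝ
  contMDiff : ContMDiff (𝓡 n) 𝓘(ℝ) ∞ toFun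
  pos (x : M) : 0 < toFun x

/-- The critical exponent `p = 2n / (n - 2)`. -/
def critExp (n : ℕ) : ℝ := 2 * (n : ℝ) / ((n : ℝ) - 2)

/-- The conformal metric `u ^ (p - 2) g`. -/
def conformalMetric (g : RiemannianMetric n M) (u : PosSmooth n M) : RiemannianMetric n M :=
  conformal g (fun x => u.toFun x ^ (critExp n - 2))
    (fun x => (Real.contDiffAt_rpow_const_of_ne (u.pos x).ne').contMDiffAt.comp x (u.contMDiff x))
    (fun x => Real.rpow_pos_of_pos (u.pos x) _)

/-- The Yamabe-type functional `Q_{g,J}(u) = (∫ S̃_J dV_g̃) / (∫ dV_g̃) ^ (2 / p)` for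
`g̃ = u ^ (p - 2) g`. -/
def yamabeQuotient [MeasurableSpace M] (g : RiemannianMetric n M) (J : AlmostComplexStructure n M)
    (u : PosSmooth n M) : ℝ :=
  (∫ x, holoScalarCurvature (conformalMetric g u) J x ∂(volumeMeasure (conformalMetric g u))) /
    (volumeMeasure (conformalMetric g u)).real Set.univ ^ (2 / critExp n)

/-- The conformal invariant `Y(M, g, J) = inf {Q_{g,J}(u) : u ∈ C^∞(M), u > 0}`. The infimum is
taken in the extended reals, so that it is the true infimum without any boundedness condition. -/
def yamabeInvariant [MeasurableSpace M] (g : RiemannianMetric n M)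
    (J : AlmostComplexStructure n M) : EReal :=
  ⨅ u : PosSmooth n M, ((yamabeQuotient g J u : ℝ) : EReal)

end AlmostHermitian

end

/-! For integrable `J` the total holomorphic d-scalar curvature of every compatible metric is
nonnegative. A conformal change preserves compatibility, so every quotient in the infimum is
nonnegative, and `Y < 0` rules out integrability.

The nonnegativity comes from a pointwise formula, `IsHermitianOn.scalar_sub_starScalar_eq`: `S_J = 2
div V + |δJ|²`, with `δJ = ∑ g^{ab} (∇_a J) ∂_b` and `V = J δJ`. By the Ricci identity, `Ric - Ric*`
is a contraction of `J` with antisymmetrised second covariant derivatives of `J`. Differentiating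
`J² = -1` twice and using that `J` is skew reduces everything to one contraction of `∇∇J`, equal to
`div V + |δJ|²`, and two contractions quadratic in `∇J`. One of these is `-|δJ|²`. The other
vanishes when `∇_{JX} J = J ∇_X J`, which is integrability expressed through the Levi-Civita
connection (`IsHermitianOn.covDeriv_of_nijenhuisVanishes`). The Nijenhuis condition is obtained by
differentiating `df ∘ J = i df` for a holomorphic chart `f` (`nijenhuisVanishes_of_fderiv`).

It remains to show `∫ div V = 0` on a closed manifold (`integral_leeDivergence_one`). The divergence
of a multiple of `V` is independent of the chart, a partition of unity localises it, and in one
chart the claim is integration by parts in Euclidean space. -/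

noncomputable section

namespace AlmostHermitian

/-! ### Partial derivatives of scalar and matrix functions on Euclidean space. -/

section Calculus

variable {n : ℕ} {y : EuclideanSpace ℝ (Fin n)} {i : Fin n}

lemma pderiv_const (c : ℝ) : pderiv i (fun _ => c) y = 0 := by
  simp [pderiv]

lemma pderiv_add {f h : EuclideanSpace ℝ (Fin n) → ℝ} (hf : DifferentiableAt ℝ f y)
    (hh : DifferentiableAt ℝ h y) :
    pderiv i (fun z => f z + h z) y = pderiv i f y + pderiv i h y := by
  simp [pderiv, fderiv_fun_add hf hh]

lemma pderiv_mul {f h : EuclideanSpace ℝ (Fin n) → ℝ} (hf : DifferentiableAt ℝ f y)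
    (hh : DifferentiableAt ℝ h y) :
    pderiv i (fun z => f z * h z) y = pderiv i f y * h y + f y * pderiv i h y := by
  simp [pderiv, fderiv_fun_mul hf hh]; ring

lemma pderiv_sum {ι : Type*} {s : Finset ι} {f : ι → EuclideanSpace ℝ (Fin n) → ℝ}
    (hf : ∀ j ∈ s, DifferentiableAt ℝ (f j) y) :
    pderiv i (fun z => ∑ j ∈ s, f j z) y = ∑ j ∈ s, pderiv i (f j) y := by
  simp [pderiv, fderiv_fun_sum hf]

lemma pderiv_congr {f h : EuclideanSpace ℝ (Fin n) → ℝ} (hfh : f =ᶠ[nhds y] h) :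
    pderiv i f y = pderiv i h y := by
  simp [pderiv, hfh.fderiv_eq]

lemma fderiv_eq_sum_pderiv (f : EuclideanSpace ℝ (Fin n) → ℝ) (y v : EuclideanSpace ℝ (Fin n)) :
    fderiv ℝ f y v = ∑ k, v k * pderiv k f y := by
  have hv : v = ∑ k, v k • EuclideanSpace.single k (1 : ℝ) := by
    ext j; simp [Pi.single_apply]
  conv_lhs => rw [hv]
  simp [pderiv]

/-- Chain rule for partial derivatives. -/
lemma pderiv_comp {f : EuclideanSpace ℝ (Fin n) → ℝ}
    {Φ : EuclideanSpace ℝ (Fin n) → EuclideanSpace ℝ (Fin n)}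
    (hf : DifferentiableAt ℝ f (Φ y)) (hΦ : DifferentiableAt ℝ Φ y) :
    pderiv i (fun z => f (Φ z)) y = ∑ k, pderiv i (fun z => Φ z k) y * pderiv k f (Φ y) := by
  have h1 : fderiv ℝ (fun z => f (Φ z)) y = (fderiv ℝ f (Φ y)).comp (fderiv ℝ Φ y) :=
    fderiv_comp y hf hΦ
  have h2 (k : Fin n) : pderiv i (fun z => Φ z k) y =
      (fderiv ℝ Φ y (EuclideanSpace.single i 1)) k := by
    have := ((EuclideanSpace.proj (𝕜 := ℝ) k).hasFDerivAt.comp y hΦ.hasFDerivAt).fderiv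
    simp only [pderiv]
    rw [show (fun z => Φ z k) = (EuclideanSpace.proj (𝕜 := ℝ) k) ∘ Φ from rfl, this]
    rfl
  simp_rw [h2, pderiv, h1, ContinuousLinearMap.comp_apply]
  exact fderiv_eq_sum_pderiv _ _ _

lemma contDiffOn_pderiv {f : EuclideanSpace ℝ (Fin n) → ℝ} {U : Set (EuclideanSpace ℝ (Fin n))}
    (hU : IsOpen U) (hf : ContDiffOn ℝ ∞ f U) (i : Fin n) : ContDiffOn ℝ ∞ (pderiv i f) U :=
  (hf.fderiv_of_isOpen hU (by simp)).clm_apply contDiffOn_const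

lemma pderiv_comm {f : EuclideanSpace ℝ (Fin n) → ℝ} {U : Set (EuclideanSpace ℝ (Fin n))}
    (hU : IsOpen U) (hf : ContDiffOn ℝ ∞ f U) (hy : y ∈ U) (i j : Fin n) :
    pderiv i (pderiv j f) y = pderiv j (pderiv i f) y := by
  have hfy : ContDiffAt ℝ ∞ f y := hf.contDiffAt (hU.mem_nhds hy)
  have hd : DifferentiableAt ℝ (fderiv ℝ f) y :=
    ((hf.fderiv_of_isOpen hU (m := ∞) (by simp)).differentiableOn (by simp)).differentiableAt
      (hU.mem_nhds hy)
  have h (k l : Fin n) : pderiv k (pderiv l f) y =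
      fderiv ℝ (fderiv ℝ f) y (EuclideanSpace.single k 1) (EuclideanSpace.single l 1) := by
    unfold pderiv
    rw [fderiv_clm_apply hd (by fun_prop)]
    simp
  rw [h, h]
  exact (hfy.isSymmSndFDerivAt (by simpa using WithTop.coe_le_coe.2 (le_top (a := (2 : ℕ∞))))) _ _

/-- Entrywise partial derivative of a matrix-valued function. -/
def matPderiv (i : Fin n) (F : EuclideanSpace ℝ (Fin n) → Matrix (Fin n) (Fin n) ℝ)
    (y : EuclideanSpace ℝ (Fin n)) : Matrix (Fin n) (Fin n) ℝ :=
  Matrix.of fun a b => pderiv i (fun z => F z a b) y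

/-- Entrywise smoothness of a matrix-valued function. -/
def MatSmoothOn (F : EuclideanSpace ℝ (Fin n) → Matrix (Fin n) (Fin n) ℝ)
    (U : Set (EuclideanSpace ℝ (Fin n))) : Prop :=
  ∀ a b, ContDiffOn ℝ ∞ (fun z => F z a b) U

variable {U : Set (EuclideanSpace ℝ (Fin n))}
  {F K : EuclideanSpace ℝ (Fin n) → Matrix (Fin n) (Fin n) ℝ}

lemma differentiableAt_of_contDiffOn {f : EuclideanSpace ℝ (Fin n) → ℝ} (hU : IsOpen U)
    (hf : ContDiffOn ℝ ∞ f U) (hy : y ∈ U) : DifferentiableAt ℝ f y :=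
  (hf.differentiableOn (by simp)).differentiableAt (hU.mem_nhds hy)

lemma MatSmoothOn.differentiableAt (hF : MatSmoothOn F U) (hU : IsOpen U) (hy : y ∈ U)
    (a b : Fin n) : DifferentiableAt ℝ (fun z => F z a b) y :=
  differentiableAt_of_contDiffOn hU (hF a b) hy

lemma MatSmoothOn.mul (hF : MatSmoothOn F U) (hK : MatSmoothOn K U) :
    MatSmoothOn (fun z => F z * K z) U := fun a b => by
  simp only [Matrix.mul_apply]
  exact ContDiffOn.sum fun j _ => (hF a j).mul (hK j b)

lemma MatSmoothOn.add (hF : MatSmoothOn F U) (hK : MatSmoothOn K U) :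
    MatSmoothOn (fun z => F z + K z) U := fun a b => (hF a b).add (hK a b)

lemma MatSmoothOn.sub (hF : MatSmoothOn F U) (hK : MatSmoothOn K U) :
    MatSmoothOn (fun z => F z - K z) U := fun a b => (hF a b).sub (hK a b)

lemma MatSmoothOn.transpose (hF : MatSmoothOn F U) :
    MatSmoothOn (fun z => (F z).transpose) U := fun a b => hF b a

lemma MatSmoothOn.matPderiv (hU : IsOpen U) (hF : MatSmoothOn F U) (i : Fin n) :
    MatSmoothOn (matPderiv i F) U := fun a b => contDiffOn_pderiv hU (hF a b) i

lemma MatSmoothOn.det (hF : MatSmoothOn F U) : ContDiffOn ℝ ∞ (fun z => (F z).det) U := by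
  simp only [Matrix.det_apply, zsmul_eq_mul, Units.smul_def]
  exact ContDiffOn.sum fun σ _ => contDiffOn_const.mul (contDiffOn_prod fun j _ => hF _ _)

/-- The inverse is the adjugate divided by the determinant, and both are polynomial in the entries.
-/
lemma MatSmoothOn.inv (hF : MatSmoothOn F U) (hdet : ∀ z ∈ U, (F z).det ≠ 0) :
    MatSmoothOn (fun z => (F z)⁻¹) U := fun a b => by
  have hadj : ContDiffOn ℝ ∞ (fun z => (F z).adjugate a b) U := by
    simp only [Matrix.adjugate_apply]
    refine MatSmoothOn.det fun c d => ?_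
    simp only [Matrix.updateRow_apply]
    split_ifs
    · exact contDiffOn_const
    · exact hF c d
  simp only [Matrix.inv_def, Matrix.smul_apply, Ring.inverse_eq_inv', smul_eq_mul]
  exact (hF.det.inv hdet).mul hadj

lemma matPderiv_mul (hU : IsOpen U) (hF : MatSmoothOn F U) (hK : MatSmoothOn K U) (hy : y ∈ U) :
    matPderiv i (fun z => F z * K z) y = matPderiv i F y * K y + F y * matPderiv i K y := by
  ext a b
  simp only [matPderiv, Matrix.mul_apply, Matrix.add_apply, Matrix.of_apply]
  rw [pderiv_sum fun j _ => (hF.differentiableAt hU hy a j).fun_mul (hK.differentiableAt hU hy j b),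
    ← Finset.sum_add_distrib]
  exact Finset.sum_congr rfl fun j _ =>
    pderiv_mul (hF.differentiableAt hU hy a j) (hK.differentiableAt hU hy j b)

lemma matPderiv_add (hU : IsOpen U) (hF : MatSmoothOn F U) (hK : MatSmoothOn K U) (hy : y ∈ U) :
    matPderiv i (fun z => F z + K z) y = matPderiv i F y + matPderiv i K y := by
  ext a b
  exact pderiv_add (hF.differentiableAt hU hy a b) (hK.differentiableAt hU hy a b)

lemma matPderiv_sub (hU : IsOpen U) (hF : MatSmoothOn F U) (hK : MatSmoothOn K U) (hy : y ∈ U) :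
    matPderiv i (fun z => F z - K z) y = matPderiv i F y - matPderiv i K y := by
  ext a b
  have := fderiv_fun_sub (hF.differentiableAt hU hy a b) (hK.differentiableAt hU hy a b)
  simp [matPderiv, pderiv, this]

lemma matPderiv_transpose :
    matPderiv i (fun z => (F z).transpose) y = (matPderiv i F y).transpose := rfl

lemma matPderiv_const (B : Matrix (Fin n) (Fin n) ℝ) : matPderiv i (fun _ => B) y = 0 := by
  ext a b; exact pderiv_const _

lemma matPderiv_congr (h : F =ᶠ[nhds y] K) : matPderiv i F y = matPderiv i K y := by
  ext a b
  exact pderiv_congr (h.mono fun z hz => by simp only [hz])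

lemma matPderiv_comm (hU : IsOpen U) (hF : MatSmoothOn F U) (hy : y ∈ U) (i j : Fin n) :
    matPderiv i (matPderiv j F) y = matPderiv j (matPderiv i F) y := by
  ext a b
  exact pderiv_comm hU (hF a b) hy i j

lemma matPderiv_inv (hU : IsOpen U) (hF : MatSmoothOn F U) (hdet : ∀ z ∈ U, (F z).det ≠ 0)
    (hy : y ∈ U) :
    matPderiv i (fun z => (F z)⁻¹) y = -((F y)⁻¹ * matPderiv i F y * (F y)⁻¹) := by
  have h1 : matPderiv i (fun z => (F z)⁻¹ * F z) y = 0 := by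
    rw [← matPderiv_const (1 : Matrix (Fin n) (Fin n) ℝ) (i := i) (y := y)]
    refine matPderiv_congr ?_
    filter_upwards [hU.mem_nhds hy] with z hz
    exact Matrix.nonsing_inv_mul _ (isUnit_iff_ne_zero.2 (hdet z hz))
  rw [matPderiv_mul hU (hF.inv hdet) hF hy] at h1
  have h2 : F y * (F y)⁻¹ = 1 := Matrix.mul_nonsing_inv _ (isUnit_iff_ne_zero.2 (hdet y hy))
  have h3 := congrArg (· * (F y)⁻¹) h1
  simp only [add_mul, Matrix.mul_assoc, h2, mul_one, zero_mul] at h3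
  rw [Matrix.mul_assoc]
  exact eq_neg_of_add_eq_zero_left h3

/-- Jacobi's formula for the derivative of a determinant. -/
lemma pderiv_det (hU : IsOpen U) (hF : MatSmoothOn F U) (hdet : (F y).det ≠ 0) (hy : y ∈ U) :
    pderiv i (fun z => (F z).det) y = (F y).det * ((F y)⁻¹ * matPderiv i F y).trace := by
  have hd := hF.differentiableAt hU hy
  have hprod (σ : Equiv.Perm (Fin n)) : DifferentiableAt ℝ (fun z => ∏ j, F z (σ j) j) y :=
    (HasFDerivAt.finsetProd (u := Finset.univ) fun j _ => (hd (σ j) j).hasFDerivAt).differentiableAt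
  -- The Leibniz rule on each product in the permutation expansion gives determinants with one
  -- column differentiated; Cramer's rule then turns them into the adjugate, that is `det F` times
  -- the inverse.
  have key : pderiv i (fun z => (F z).det) y =
      ∑ k, ((F y).updateCol k fun a => matPderiv i F y a k).det := by
    simp only [Matrix.det_apply, Units.smul_def, zsmul_eq_mul]
    rw [pderiv_sum fun σ _ => (differentiableAt_const _).fun_mul
      (hprod σ), Finset.sum_comm]
    refine Finset.sum_congr rfl fun σ _ => ?_
    rw [pderiv_mul (differentiableAt_const _) (hprod σ),
      pderiv_const, zero_mul, zero_add, ← Finset.mul_sum]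
    congr 1
    have hp := HasFDerivAt.finsetProd (u := Finset.univ) (x := y)
      (fun j _ => (hd (σ j) j).hasFDerivAt)
    unfold pderiv
    rw [hp.fderiv, _root_.sum_apply]
    refine Finset.sum_congr rfl fun k _ => ?_
    rw [← Finset.mul_prod_erase _ _ (Finset.mem_univ k), Matrix.updateCol_self,
      smul_apply, smul_eq_mul, mul_comm]
    congr 1
    refine Finset.prod_congr rfl fun j hj => ?_
    rw [Matrix.updateCol_ne (Finset.ne_of_mem_erase hj)]
  rw [key, Matrix.trace, Finset.mul_sum]
  refine Finset.sum_congr rfl fun k _ => ?_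
  rw [← Matrix.cramer_apply, Matrix.cramer_eq_adjugate_mulVec, Matrix.inv_def, Matrix.smul_mul,
    Matrix.diag_smul, Pi.smul_apply, smul_eq_mul, ← mul_assoc, Ring.inverse_eq_inv',
    mul_inv_cancel₀ hdet, one_mul]
  rfl

end Calculus

/-! ### The Levi-Civita connection on endomorphism fields, in one coordinate domain. -/

section LocalGeometry

variable {n : ℕ}

/-- The matrix of `∇_{∂ᵢ}`: its entry at `(k, j)` is `Γ^k_{ij}`. -/
def christoffelMatrix (G : EuclideanSpace ℝ (Fin n) → Matrix (Fin n) (Fin n) ℝ) (i : Fin n)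
    (y : EuclideanSpace ℝ (Fin n)) : Matrix (Fin n) (Fin n) ℝ :=
  Matrix.of fun k j => christoffel G k i j y

/-- The covariant derivative of an endomorphism field along `∂ᵢ`. -/
def covDeriv (G : EuclideanSpace ℝ (Fin n) → Matrix (Fin n) (Fin n) ℝ) (i : Fin n)
    (B : EuclideanSpace ℝ (Fin n) → Matrix (Fin n) (Fin n) ℝ)
    (y : EuclideanSpace ℝ (Fin n)) : Matrix (Fin n) (Fin n) ℝ :=
  matPderiv i B y + christoffelMatrix G i y * B y - B y * christoffelMatrix G i y

/-- The divergence `ρ⁻¹ ∂ₖ (ρ Xᵏ)` of a vector field with respect to a density `ρ`. -/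
def divergence (ρ : EuclideanSpace ℝ (Fin n) → ℝ) (X : EuclideanSpace ℝ (Fin n) → Fin n → ℝ)
    (y : EuclideanSpace ℝ (Fin n)) : ℝ :=
  (∑ k, pderiv k (fun z => ρ z * X z k) y) / ρ y

/-- The Riemannian density `√(det g_{ij})`. -/
def density (G : EuclideanSpace ℝ (Fin n) → Matrix (Fin n) (Fin n) ℝ)
    (y : EuclideanSpace ℝ (Fin n)) : ℝ :=
  Real.sqrt (G y).det

/-- The vector field `∑ g^{ab} (∇_a J) ∂_b`, written as the divergence of the bivector dual to the
fundamental form. -/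
def divJ (G A : EuclideanSpace ℝ (Fin n) → Matrix (Fin n) (Fin n) ℝ)
    (y : EuclideanSpace ℝ (Fin n)) (k : Fin n) : ℝ :=
  divergence (density G) (fun z => (A z * (G z)⁻¹) k) y

/-- The Lee vector field `J (∑ g^{ab} (∇_a J) ∂_b)`. -/
def leeField (G A : EuclideanSpace ℝ (Fin n) → Matrix (Fin n) (Fin n) ℝ)
    (y : EuclideanSpace ℝ (Fin n)) : Fin n → ℝ :=
  (A y).mulVec (divJ G A y)

/-- Coordinate data of an almost Hermitian structure on an open set: a smooth symmetric positive
matrix `G`, and a smooth `A` with `A ^ 2 = -1` and `Aᵀ G A = G`. -/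
structure IsHermitianOn (G A : EuclideanSpace ℝ (Fin n) → Matrix (Fin n) (Fin n) ℝ)
    (U : Set (EuclideanSpace ℝ (Fin n))) : Prop where
  isOpen : IsOpen U
  smooth_metric : MatSmoothOn G U
  smooth_complex : MatSmoothOn A U
  symm : ∀ z ∈ U, (G z).transpose = G z
  det_pos : ∀ z ∈ U, 0 < (G z).det
  sq_eq : ∀ z ∈ U, A z * A z = -1
  compat : ∀ z ∈ U, (A z).transpose * G z * A z = G z

/-- The vanishing of the Nijenhuis tensor of `A` at `y`, in the form: the bilinear map
`(X, Y) ↦ (∂_{AX} A) Y - A (∂_X A) Y` is symmetric. -/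
def NijenhuisVanishes (A : EuclideanSpace ℝ (Fin n) → Matrix (Fin n) (Fin n) ℝ)
    (y : EuclideanSpace ℝ (Fin n)) : Prop :=
  ∀ a b c, ∑ m, A y m a * matPderiv m A y c b - (A y * matPderiv a A y) c b =
    ∑ m, A y m b * matPderiv m A y c a - (A y * matPderiv b A y) c a

variable {G A B K : EuclideanSpace ℝ (Fin n) → Matrix (Fin n) (Fin n) ℝ}
  {U : Set (EuclideanSpace ℝ (Fin n))} {y : EuclideanSpace ℝ (Fin n)}

namespace IsHermitianOn

lemma det_ne (h : IsHermitianOn G A U) : ∀ z ∈ U, (G z).det ≠ 0 :=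
  fun z hz => (h.det_pos z hz).ne'

lemma inv_mul (h : IsHermitianOn G A U) (hy : y ∈ U) : (G y)⁻¹ * G y = 1 :=
  Matrix.nonsing_inv_mul _ (isUnit_iff_ne_zero.2 (h.det_ne y hy))

lemma mul_inv (h : IsHermitianOn G A U) (hy : y ∈ U) : G y * (G y)⁻¹ = 1 :=
  Matrix.mul_nonsing_inv _ (isUnit_iff_ne_zero.2 (h.det_ne y hy))

lemma smooth_inv (h : IsHermitianOn G A U) : MatSmoothOn (fun z => (G z)⁻¹) U :=
  h.smooth_metric.inv h.det_ne

lemma inv_symm (h : IsHermitianOn G A U) (hy : y ∈ U) : ((G y)⁻¹).transpose = (G y)⁻¹ := by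
  rw [Matrix.transpose_nonsing_inv, h.symm y hy]

lemma smooth_christoffelMatrix (h : IsHermitianOn G A U) (i : Fin n) :
    MatSmoothOn (christoffelMatrix G i) U := fun k j => by
  have hp := fun a b c => contDiffOn_pderiv h.isOpen (h.smooth_metric a b) c
  exact contDiffOn_const.mul (ContDiffOn.sum fun l _ =>
    (h.smooth_inv k l).mul (((hp j l i).add (hp i l j)).sub (hp i j l)))

lemma christoffelMatrix_symm (h : IsHermitianOn G A U) (hy : y ∈ U) (i j k : Fin n) :
    christoffelMatrix G i y k j = christoffelMatrix G j y k i := by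
  have hs : ∀ l, pderiv l (fun z => G z i j) y = pderiv l (fun z => G z j i) y := fun l =>
    pderiv_congr <| by
      filter_upwards [h.isOpen.mem_nhds hy] with z hz
      exact (congrFun (congrFun (h.symm z hz) j) i)
  simp only [christoffelMatrix, christoffel, Matrix.of_apply]
  congr 1
  refine Finset.sum_congr rfl fun l _ => ?_
  rw [hs]; ring

/-- Lowering the index cancels the inverse metric and leaves Christoffel symbols of the first kind,
from which metric compatibility is linear algebra. -/
lemma metric_mul_christoffelMatrix (h : IsHermitianOn G A U) (hy : y ∈ U) (i a b : Fin n) :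
    (G y * christoffelMatrix G i y) a b = (1 / 2 : ℝ) * (matPderiv i G y b a +
      matPderiv b G y i a - matPderiv a G y i b) := by
  have : christoffelMatrix G i y = (1 / 2 : ℝ) • ((G y)⁻¹ * Matrix.of fun l j =>
      (matPderiv i G y j l + matPderiv j G y i l - matPderiv l G y i j)) := by
    ext k j; simp [christoffelMatrix, christoffel, Matrix.mul_apply, matPderiv]
  rw [this, Matrix.mul_smul, ← Matrix.mul_assoc, h.mul_inv hy, one_mul]
  rfl

/-- The Levi-Civita connection is metric. -/
lemma matPderiv_metric (h : IsHermitianOn G A U) (hy : y ∈ U) (i : Fin n) :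
    matPderiv i G y = (christoffelMatrix G i y).transpose * G y + G y * christoffelMatrix G i y := by
  have hs (l : Fin n) : (matPderiv l G y).transpose = matPderiv l G y := by
    rw [← matPderiv_transpose]
    exact matPderiv_congr (by filter_upwards [h.isOpen.mem_nhds hy] with z hz using h.symm z hz)
  have hs' (l a b : Fin n) : matPderiv l G y a b = matPderiv l G y b a :=
    congrFun (congrFun (hs l) b) a
  have ht : (christoffelMatrix G i y).transpose * G y =
      (G y * christoffelMatrix G i y).transpose := by
    rw [Matrix.transpose_mul, h.symm y hy]
  rw [ht]
  ext a b
  rw [Matrix.add_apply, Matrix.transpose_apply, h.metric_mul_christoffelMatrix hy,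
    h.metric_mul_christoffelMatrix hy, hs' i b a]
  rw [hs' b i a, hs' a i b, hs' b a i, hs' a b i]
  ring

lemma matPderiv_inv_metric (h : IsHermitianOn G A U) (hy : y ∈ U) (i : Fin n) :
    matPderiv i (fun z => (G z)⁻¹) y = -(christoffelMatrix G i y * (G y)⁻¹) -
      (G y)⁻¹ * (christoffelMatrix G i y).transpose := by
  rw [matPderiv_inv h.isOpen h.smooth_metric h.det_ne hy, h.matPderiv_metric hy]
  have h1 := h.mul_inv hy
  have h2 := h.inv_mul hy
  simp only [mul_add, add_mul, neg_add]
  rw [Matrix.mul_assoc, Matrix.mul_assoc, h1, mul_one, ← Matrix.mul_assoc (G y)⁻¹ (G y), h2,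
    one_mul]
  abel

lemma smooth_covDeriv (h : IsHermitianOn G A U) (hB : MatSmoothOn B U) (i : Fin n) :
    MatSmoothOn (covDeriv G i B) U :=
  ((hB.matPderiv h.isOpen i).add ((h.smooth_christoffelMatrix i).mul hB)).sub
    (hB.mul (h.smooth_christoffelMatrix i))

lemma covDeriv_mul (h : IsHermitianOn G A U) (hB : MatSmoothOn B U) (hK : MatSmoothOn K U)
    (hy : y ∈ U) (i : Fin n) : covDeriv G i (fun z => B z * K z) y =
      covDeriv G i B y * K y + B y * covDeriv G i K y := by
  unfold covDeriv
  rw [matPderiv_mul h.isOpen hB hK hy]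
  noncomm_ring

lemma covDeriv_add (h : IsHermitianOn G A U) (hB : MatSmoothOn B U) (hK : MatSmoothOn K U)
    (hy : y ∈ U) (i : Fin n) : covDeriv G i (fun z => B z + K z) y =
      covDeriv G i B y + covDeriv G i K y := by
  unfold covDeriv
  rw [matPderiv_add h.isOpen hB hK hy]
  noncomm_ring

lemma covDeriv_congr (h : IsHermitianOn G A U) (hBK : ∀ z ∈ U, B z = K z)
    (hy : y ∈ U) (i : Fin n) : covDeriv G i B y = covDeriv G i K y := by
  unfold covDeriv
  rw [hBK y hy, matPderiv_congr (Filter.eventually_of_mem (h.isOpen.mem_nhds hy) hBK)]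

lemma covDeriv_zero (i : Fin n) : covDeriv G i (fun _ => 0) y = 0 := by
  simp [covDeriv, matPderiv_const]

/-- Covariant derivatives of skew-adjoint endomorphisms are skew-adjoint. -/
lemma covDeriv_skew (h : IsHermitianOn G A U) (hB : MatSmoothOn B U)
    (hs : ∀ z ∈ U, B z * (G z)⁻¹ + (G z)⁻¹ * (B z).transpose = 0) (hy : y ∈ U) (i : Fin n) :
    covDeriv G i B y * (G y)⁻¹ + (G y)⁻¹ * (covDeriv G i B y).transpose = 0 := by
  have h1 : matPderiv i (fun z => B z * (G z)⁻¹ + (G z)⁻¹ * (B z).transpose) y = 0 := by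
    rw [← matPderiv_const (0 : Matrix (Fin n) (Fin n) ℝ) (i := i) (y := y)]
    exact matPderiv_congr (Filter.eventually_of_mem (h.isOpen.mem_nhds hy) hs)
  rw [matPderiv_add h.isOpen (hB.mul h.smooth_inv) (h.smooth_inv.mul hB.transpose) hy,
    matPderiv_mul h.isOpen hB h.smooth_inv hy, matPderiv_mul h.isOpen h.smooth_inv hB.transpose hy,
    h.matPderiv_inv_metric hy, matPderiv_transpose] at h1
  have h2 := hs y hy
  -- With `H = G⁻¹`, the desired expression is the ordinary derivative of `BH + HBᵀ` plus `Γ(BH +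
  -- HBᵀ)` plus `(BH + HBᵀ)Γᵀ`. All three vanish; zero is written below as a sum of three zeros so
  -- that each can be substituted.
  have h3 : christoffelMatrix G i y * (B y * (G y)⁻¹ + (G y)⁻¹ * (B y).transpose) = 0 := by
    rw [h2, mul_zero]
  have h4 : (B y * (G y)⁻¹ + (G y)⁻¹ * (B y).transpose) * (christoffelMatrix G i y).transpose = 0 := by
    rw [h2, zero_mul]
  unfold covDeriv
  simp only [Matrix.transpose_add, Matrix.transpose_sub, Matrix.transpose_mul]
  rw [← add_zero (0 : Matrix (Fin n) (Fin n) ℝ), ← add_zero ((0 : Matrix (Fin n) (Fin n) ℝ) + 0)]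
  nth_rewrite 2 [← h1]
  nth_rewrite 1 [← h3]
  rw [← h4]
  noncomm_ring

/-- Multiplying `AᵀGA = G` by `A` and using `A² = -1` gives `AᵀG = -GA`. In the raised form used
here it says that the bivector `A G⁻¹` is antisymmetric. -/
lemma skew (h : IsHermitianOn G A U) (hy : y ∈ U) :
    A y * (G y)⁻¹ + (G y)⁻¹ * (A y).transpose = 0 := by
  have h1 : (A y).transpose * G y = -(G y * A y) := by
    have := congrArg (· * A y) (h.compat y hy)
    simp only [Matrix.mul_assoc, h.sq_eq y hy] at this
    rw [← this]; simp
  have h2 := congrArg (fun X => (G y)⁻¹ * X * (G y)⁻¹) h1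
  simp only [Matrix.mul_assoc, h.mul_inv hy, mul_one, Matrix.mul_neg, Matrix.neg_mul] at h2
  rw [← Matrix.mul_assoc (G y)⁻¹ (G y), h.inv_mul hy, one_mul] at h2
  rw [h2]; abel

lemma anticomm (h : IsHermitianOn G A U) (hy : y ∈ U) (i : Fin n) :
    A y * covDeriv G i A y = -(covDeriv G i A y * A y) := by
  have h1 := h.covDeriv_mul h.smooth_complex h.smooth_complex hy i
  rw [h.covDeriv_congr h.sq_eq hy] at h1
  have h2 : covDeriv G i (fun _ => (-1 : Matrix (Fin n) (Fin n) ℝ)) y = 0 := by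
    simp [covDeriv, matPderiv_const]
  rw [h2] at h1
  exact eq_neg_of_add_eq_zero_right h1.symm

/-- The second derivative of `A² = -1`. Its quadratic terms are the source of `|δJ|²` in the
curvature formula. -/
lemma covDeriv_anticomm (h : IsHermitianOn G A U) (hy : y ∈ U) (i j : Fin n) :
    A y * covDeriv G i (covDeriv G j A) y + covDeriv G i (covDeriv G j A) y * A y +
      covDeriv G i A y * covDeriv G j A y + covDeriv G j A y * covDeriv G i A y = 0 := by
  have hC := h.smooth_covDeriv h.smooth_complex j
  have h1 : covDeriv G i (fun z => A z * covDeriv G j A z + covDeriv G j A z * A z) y = 0 := by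
    rw [← covDeriv_zero (G := G) (y := y) i]
    refine h.covDeriv_congr (fun z hz => ?_) hy i
    rw [h.anticomm hz]; abel
  rw [h.covDeriv_add (h.smooth_complex.mul hC) (hC.mul h.smooth_complex) hy,
    h.covDeriv_mul h.smooth_complex hC hy, h.covDeriv_mul hC h.smooth_complex hy] at h1
  rw [← h1]; abel

end IsHermitianOn

/-- The curvature endomorphism `R(∂ᵢ, ∂ⱼ)`. -/
def curvMatrix (G : EuclideanSpace ℝ (Fin n) → Matrix (Fin n) (Fin n) ℝ) (i j : Fin n)
    (y : EuclideanSpace ℝ (Fin n)) : Matrix (Fin n) (Fin n) ℝ :=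
  Matrix.of fun l k => curv G l i j k y

lemma curvMatrix_eq (i j : Fin n) : curvMatrix G i j y =
    -(matPderiv i (christoffelMatrix G j) y - matPderiv j (christoffelMatrix G i) y +
      (christoffelMatrix G i y * christoffelMatrix G j y -
        christoffelMatrix G j y * christoffelMatrix G i y)) := by
  ext l k
  simp only [curvMatrix, curv, Matrix.of_apply, Matrix.neg_apply, Matrix.add_apply,
    Matrix.sub_apply, Matrix.mul_apply, matPderiv, christoffelMatrix, Finset.sum_sub_distrib]


/-- The Ricci identity for endomorphism fields. -/
lemma IsHermitianOn.covDeriv_comm (h : IsHermitianOn G A U) (hB : MatSmoothOn B U) (hy : y ∈ U)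
    (i j : Fin n) : covDeriv G j (covDeriv G i B) y - covDeriv G i (covDeriv G j B) y =
      curvMatrix G i j y * B y - B y * curvMatrix G i j y := by
  have hΓ := h.smooth_christoffelMatrix
  have key (i j : Fin n) : matPderiv j (covDeriv G i B) y = matPderiv j (matPderiv i B) y +
      (matPderiv j (christoffelMatrix G i) y * B y + christoffelMatrix G i y * matPderiv j B y) -
      (matPderiv j B y * christoffelMatrix G i y + B y * matPderiv j (christoffelMatrix G i) y) := by
    unfold covDeriv
    have hO := h.isOpen
    rw [matPderiv_sub hO ((hB.matPderiv hO i).add ((hΓ i).mul hB)) (hB.mul (hΓ i)) hy,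
      matPderiv_add hO (hB.matPderiv hO i) ((hΓ i).mul hB) hy, matPderiv_mul hO (hΓ i) hB hy,
      matPderiv_mul hO hB (hΓ i) hy]
  have e1 (i j : Fin n) : covDeriv G j (covDeriv G i B) y = matPderiv j (covDeriv G i B) y +
      christoffelMatrix G j y * covDeriv G i B y - covDeriv G i B y * christoffelMatrix G j y := rfl
  have e2 (i : Fin n) : covDeriv G i B y = matPderiv i B y + christoffelMatrix G i y * B y -
    B y * christoffelMatrix G i y := rfl
  -- Second partials of `B` cancel and the brackets of Christoffel matrices remain. The iterated
  -- `covDeriv` carries no correction for the direction index; by torsion-freeness such a correction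
  -- would cancel in the commutator. The order of `i` and `j` matches the sign convention for `R`.
  rw [e1, e1, key, key, e2, e2, matPderiv_comm h.isOpen hB hy j i, curvMatrix_eq]
  noncomm_ring

end LocalGeometry

/-! ### The formula `S_J = 2 div V + |δJ|²` in coordinates. -/

section LocalIdentity

variable {n : ℕ} {G A : EuclideanSpace ℝ (Fin n) → Matrix (Fin n) (Fin n) ℝ}
  {U : Set (EuclideanSpace ℝ (Fin n))} {y : EuclideanSpace ℝ (Fin n)}

namespace IsHermitianOn

lemma density_pos (h : IsHermitianOn G A U) (hy : y ∈ U) : 0 < density G y :=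
  Real.sqrt_pos.2 (h.det_pos y hy)

lemma smooth_density (h : IsHermitianOn G A U) : ContDiffOn ℝ ∞ (density G) U :=
  h.smooth_metric.det.sqrt h.det_ne

/-- Jacobi's formula gives `∂ᵢ log √det G = ½ tr (G⁻¹ ∂ᵢG)`, and metric compatibility makes this `tr
Γᵢ`. -/
lemma pderiv_density (h : IsHermitianOn G A U) (hy : y ∈ U) (i : Fin n) :
    pderiv i (density G) y = density G y * (christoffelMatrix G i y).trace := by
  have hd := differentiableAt_of_contDiffOn h.isOpen h.smooth_metric.det hy
  have h1 : pderiv i (density G) y =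
      pderiv i (fun z => (G z).det) y / (2 * Real.sqrt (G y).det) := by
    unfold pderiv density
    rw [fderiv_sqrt hd (h.det_ne y hy)]
    simp; ring
  have h2 : ((G y)⁻¹ * matPderiv i G y).trace = 2 * (christoffelMatrix G i y).trace := by
    rw [h.matPderiv_metric hy, mul_add, Matrix.trace_add, ← Matrix.mul_assoc, Matrix.trace_mul_comm,
      ← Matrix.mul_assoc, h.mul_inv hy, one_mul, ← Matrix.mul_assoc, h.inv_mul hy, one_mul,
      Matrix.trace_transpose]
    ring
  have h3 : 0 < Real.sqrt (G y).det := h.density_pos hy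
  rw [h1, pderiv_det h.isOpen h.smooth_metric (h.det_ne y hy) hy, h2]
  unfold density
  rw [div_eq_iff (by positivity)]
  nth_rewrite 1 [← Real.mul_self_sqrt (h.det_pos y hy).le]
  ring

lemma divergence_eq (h : IsHermitianOn G A U) (hy : y ∈ U)
    {X : EuclideanSpace ℝ (Fin n) → Fin n → ℝ} (hX : ∀ k, DifferentiableAt ℝ (fun z => X z k) y) :
    divergence (density G) X y =
      ∑ k, (pderiv k (fun z => X z k) y + (christoffelMatrix G k y).mulVec (X y) k) := by
  have hρ := differentiableAt_of_contDiffOn h.isOpen h.smooth_density hy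
  have h1 : ∑ k, (christoffelMatrix G k y).mulVec (X y) k =
      ∑ k, (christoffelMatrix G k y).trace * X y k := by
    simp only [Matrix.mulVec, dotProduct, Matrix.trace, Finset.sum_mul, Matrix.diag]
    rw [Finset.sum_comm]
    refine Finset.sum_congr rfl fun l _ => Finset.sum_congr rfl fun k _ => ?_
    rw [h.christoffelMatrix_symm hy]
  rw [divergence, div_eq_iff (h.density_pos hy).ne', Finset.sum_add_distrib, h1,
    ← Finset.sum_add_distrib, Finset.sum_mul]
  refine Finset.sum_congr rfl fun k _ => ?_
  rw [pderiv_mul hρ (hX k), h.pderiv_density hy]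
  ring

/-- The contraction of an antisymmetric matrix with the Christoffel symbols vanishes. -/
lemma sum_mul_christoffelMatrix (h : IsHermitianOn G A U) (hy : y ∈ U)
    {P : Matrix (Fin n) (Fin n) ℝ} (hP : P.transpose = -P) (i : Fin n) :
    ∑ j, (P * (christoffelMatrix G j y).transpose) j i = 0 := by
  have h1 : ∑ j, (P * (christoffelMatrix G j y).transpose) j i =
      -∑ j, (P * (christoffelMatrix G j y).transpose) j i := by
    simp only [Matrix.mul_apply, Matrix.transpose_apply]
    conv_rhs => rw [Finset.sum_comm]
    simp only [← Finset.sum_neg_distrib]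
    refine Finset.sum_congr rfl fun j _ => Finset.sum_congr rfl fun l _ => ?_
    rw [h.christoffelMatrix_symm hy j l, ← Matrix.transpose_apply P, hP]
    simp
  linarith

lemma transpose_mul_inv (h : IsHermitianOn G A U) (hy : y ∈ U) {C : Matrix (Fin n) (Fin n) ℝ}
    (hC : C * (G y)⁻¹ + (G y)⁻¹ * C.transpose = 0) :
    (C * (G y)⁻¹).transpose = -(C * (G y)⁻¹) := by
  rw [Matrix.transpose_mul, h.inv_symm hy]
  exact eq_neg_of_add_eq_zero_right hC

/-- Of the two Christoffel terms in `∇_b` of the bivector `A G⁻¹`, the one correcting the free index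
`k` contracts an antisymmetric with a symmetric pair and drops out. Hence `δJ` needs only a density
and no connection, which makes its behaviour under coordinate changes accessible. -/
lemma divJ_eq (h : IsHermitianOn G A U) (hy : y ∈ U) (k : Fin n) :
    divJ G A y k = ∑ b, (covDeriv G b A y * (G y)⁻¹) k b := by
  have hs := h.smooth_complex.mul h.smooth_inv
  unfold divJ
  rw [h.divergence_eq hy (fun b => hs.differentiableAt h.isOpen hy k b)]
  have hP : ∀ z ∈ U, (A z * (G z)⁻¹).transpose = -(A z * (G z)⁻¹) :=
    fun z hz => h.transpose_mul_inv hz (h.skew hz)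
  have e1 (b : Fin n) : covDeriv G b A y * (G y)⁻¹ = matPderiv b (fun z => A z * (G z)⁻¹) y +
      christoffelMatrix G b y * (A y * (G y)⁻¹) +
      A y * (G y)⁻¹ * (christoffelMatrix G b y).transpose := by
    rw [matPderiv_mul h.isOpen h.smooth_complex h.smooth_inv hy, h.matPderiv_inv_metric hy]
    unfold covDeriv
    noncomm_ring
  have e2 : ∑ b, (christoffelMatrix G b y * (A y * (G y)⁻¹)) k b = 0 := by
    have := h.sum_mul_christoffelMatrix hy (P := A y * (G y)⁻¹) (hP y hy) k
    rw [← neg_eq_zero, ← Finset.sum_neg_distrib, ← this]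
    refine Finset.sum_congr rfl fun b _ => ?_
    rw [← Matrix.neg_apply, ← Matrix.mul_neg, ← hP y hy]
    exact congrFun (congrFun (Matrix.transpose_mul (A y * (G y)⁻¹)
      (christoffelMatrix G b y).transpose) k) b |>.symm
  simp only [e1, Matrix.add_apply, Finset.sum_add_distrib, e2, add_zero]
  congr 1
  refine Finset.sum_congr rfl fun b _ => ?_
  simp only [Matrix.mul_apply (M := A y * (G y)⁻¹), Matrix.mulVec, dotProduct,
    Matrix.transpose_apply]
  exact Finset.sum_congr rfl fun l _ => mul_comm _ _

lemma contDiffOn_divergence (h : IsHermitianOn G A U) {X : EuclideanSpace ℝ (Fin n) → Fin n → ℝ}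
    (hX : ∀ k, ContDiffOn ℝ ∞ (fun z => X z k) U) :
    ContDiffOn ℝ ∞ (divergence (density G) X) U :=
  (ContDiffOn.sum fun k _ => contDiffOn_pderiv h.isOpen (h.smooth_density.mul (hX k)) k).div
    h.smooth_density fun _ hz => (h.density_pos hz).ne'

lemma contDiffOn_divJ (h : IsHermitianOn G A U) (k : Fin n) :
    ContDiffOn ℝ ∞ (fun z => divJ G A z k) U :=
  h.contDiffOn_divergence fun b => h.smooth_complex.mul h.smooth_inv k b

lemma contDiffOn_leeField (h : IsHermitianOn G A U) (k : Fin n) :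
    ContDiffOn ℝ ∞ (fun z => leeField G A z k) U := by
  simp only [leeField, Matrix.mulVec, dotProduct]
  exact ContDiffOn.sum fun j _ => (h.smooth_complex k j).mul (h.contDiffOn_divJ j)

/-- `(∇_j δJ)^m` as a trace of second covariant derivatives of `J`. -/
lemma covDeriv_divJ (h : IsHermitianOn G A U) (hy : y ∈ U) (j m : Fin n) :
    pderiv j (fun z => divJ G A z m) y + (christoffelMatrix G j y).mulVec (divJ G A y) m =
      ∑ i, (covDeriv G j (covDeriv G i A) y * (G y)⁻¹ -
        covDeriv G i A y * (G y)⁻¹ * (christoffelMatrix G j y).transpose) m i := by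
  have hs (i : Fin n) := h.smooth_covDeriv h.smooth_complex i
  have h1 : pderiv j (fun z => divJ G A z m) y =
      ∑ i, matPderiv j (fun z => covDeriv G i A z * (G z)⁻¹) y m i := by
    rw [pderiv_congr (Filter.eventually_of_mem (h.isOpen.mem_nhds hy) fun z hz => h.divJ_eq hz m),
      pderiv_sum fun i _ => ((hs i).mul h.smooth_inv).differentiableAt h.isOpen hy m i]
    rfl
  have h2 : (christoffelMatrix G j y).mulVec (divJ G A y) m =
      ∑ i, (christoffelMatrix G j y * (covDeriv G i A y * (G y)⁻¹)) m i := by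
    simp only [Matrix.mulVec, dotProduct, h.divJ_eq hy]
    simp only [Matrix.mul_apply (M := christoffelMatrix G j y), Finset.mul_sum]
    exact Finset.sum_comm
  rw [h1, h2, ← Finset.sum_add_distrib]
  refine Finset.sum_congr rfl fun i _ => ?_
  rw [matPderiv_mul h.isOpen (hs i) h.smooth_inv hy, h.matPderiv_inv_metric hy, ← Matrix.add_apply]
  refine congrFun (congrFun ?_ m) i
  rw [show covDeriv G j (covDeriv G i A) y = matPderiv j (covDeriv G i A) y +
      christoffelMatrix G j y * covDeriv G i A y - covDeriv G i A y * christoffelMatrix G j y from rfl]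
  noncomm_ring

/-- `∑ⱼ (∇_jJ (δJ))^j = -|δJ|²`. -/
lemma sum_covDeriv_mulVec_divJ (h : IsHermitianOn G A U) (hy : y ∈ U) :
    ∑ j, (covDeriv G j A y).mulVec (divJ G A y) j =
      -(dotProduct (divJ G A y) ((G y).mulVec (divJ G A y))) := by
  set w := (G y).mulVec (divJ G A y) with hw
  -- Writing `δJ = G⁻¹ w` exposes `(∇_j J) G⁻¹`, whose antisymmetry lets the sum over `j` be
  -- recognised as `δJ` again.
  have h1 : divJ G A y = ((G y)⁻¹).mulVec w := by
    rw [hw, Matrix.mulVec_mulVec, h.inv_mul hy, Matrix.one_mulVec]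
  have h2 (j : Fin n) := h.transpose_mul_inv hy
    (h.covDeriv_skew h.smooth_complex (fun z hz => h.skew hz) hy j)
  have h3 (j l : Fin n) : (covDeriv G j A y * (G y)⁻¹) j l = -(covDeriv G j A y * (G y)⁻¹) l j := by
    rw [← Matrix.neg_apply, ← h2, Matrix.transpose_apply]
  calc ∑ j, (covDeriv G j A y).mulVec (divJ G A y) j
      = ∑ j, ∑ l, (covDeriv G j A y * (G y)⁻¹) j l * w l := by
        rw [h1]; simp only [Matrix.mulVec_mulVec]; rfl
    _ = -∑ l, divJ G A y l * w l := by
        rw [Finset.sum_comm, ← Finset.sum_neg_distrib]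
        refine Finset.sum_congr rfl fun l _ => ?_
        rw [h.divJ_eq hy, ← Finset.sum_mul, ← neg_mul, ← Finset.sum_neg_distrib]
        simp only [h3 _ l]
    _ = _ := rfl

/-- The divergence of the Lee field as a trace of second covariant derivatives of `J`. -/
lemma sum_mul_covDeriv_covDeriv (h : IsHermitianOn G A U) (hy : y ∈ U) :
    ∑ j, ∑ i, (A y * covDeriv G j (covDeriv G i A) y * (G y)⁻¹) j i =
      divergence (density G) (leeField G A) y +
        dotProduct (divJ G A y) ((G y).mulVec (divJ G A y)) := by
  have hA := h.smooth_complex.differentiableAt h.isOpen hy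
  have hW := fun k => differentiableAt_of_contDiffOn h.isOpen (h.contDiffOn_divJ k) hy
  -- This is the direction-index correction absent from the iterated `covDeriv`. It vanishes after
  -- contraction because `J ∇ᵢJ`, a product of anticommuting skew endomorphisms, is skew.
  have hX (i : Fin n) : ∑ j, (A y * covDeriv G i A y * (G y)⁻¹ *
      (christoffelMatrix G j y).transpose) j i = 0 := by
    refine h.sum_mul_christoffelMatrix hy (h.transpose_mul_inv hy ?_) i
    have hC := h.covDeriv_skew h.smooth_complex (fun z hz => h.skew hz) hy i
    have hC' : (G y)⁻¹ * (covDeriv G i A y).transpose = -(covDeriv G i A y * (G y)⁻¹) :=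
      eq_neg_of_add_eq_zero_right hC
    have hA' : (G y)⁻¹ * (A y).transpose = -(A y * (G y)⁻¹) :=
      eq_neg_of_add_eq_zero_right (h.skew hy)
    rw [Matrix.transpose_mul, ← Matrix.mul_assoc, hC', Matrix.neg_mul, Matrix.mul_assoc _ (G y)⁻¹,
      hA', Matrix.mul_neg, neg_neg, h.anticomm hy, Matrix.neg_mul, Matrix.mul_assoc]
    abel
  have hdiv : divergence (density G) (leeField G A) y =
      ∑ j, ((A y).mulVec (fun m => pderiv j (fun z => divJ G A z m) y +
        (christoffelMatrix G j y).mulVec (divJ G A y) m) j +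
          (covDeriv G j A y).mulVec (divJ G A y) j) := by
    rw [h.divergence_eq hy fun k => differentiableAt_of_contDiffOn h.isOpen
      (h.contDiffOn_leeField k) hy]
    refine Finset.sum_congr rfl fun j _ => ?_
    have h1 : pderiv j (fun z => leeField G A z j) y = (matPderiv j A y).mulVec (divJ G A y) j +
        (A y).mulVec (fun m => pderiv j (fun z => divJ G A z m) y) j := by
      simp only [leeField, Matrix.mulVec, dotProduct]
      rw [pderiv_sum fun m _ => (hA j m).fun_mul (hW m), ← Finset.sum_add_distrib]
      exact Finset.sum_congr rfl fun m _ => pderiv_mul (hA j m) (hW m)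
    rw [h1]
    simp only [covDeriv, leeField, Matrix.mulVec_mulVec, Matrix.add_mulVec, Matrix.sub_mulVec,
      Pi.add_apply, Pi.sub_apply]
    rw [show (fun m => pderiv j (fun z => divJ G A z m) y +
        (christoffelMatrix G j y).mulVec (divJ G A y) m) =
      (fun m => pderiv j (fun z => divJ G A z m) y) +
        (christoffelMatrix G j y).mulVec (divJ G A y) from rfl, Matrix.mulVec_add,
      Matrix.mulVec_mulVec, Pi.add_apply]
    ring
  rw [hdiv, Finset.sum_add_distrib, h.sum_covDeriv_mulVec_divJ hy, neg_add_cancel_right]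
  simp only [h.covDeriv_divJ hy]
  have h4 (j : Fin n) : (A y).mulVec (fun m => ∑ i, (covDeriv G j (covDeriv G i A) y * (G y)⁻¹ -
      covDeriv G i A y * (G y)⁻¹ * (christoffelMatrix G j y).transpose) m i) j =
      ∑ i, (A y * covDeriv G j (covDeriv G i A) y * (G y)⁻¹) j i -
      ∑ i, (A y * covDeriv G i A y * (G y)⁻¹ * (christoffelMatrix G j y).transpose) j i := by
    rw [← Finset.sum_sub_distrib]
    simp only [Matrix.mulVec, dotProduct, Finset.mul_sum]
    rw [Finset.sum_comm]
    refine Finset.sum_congr rfl fun i _ => ?_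
    rw [← Matrix.sub_apply, Matrix.mul_assoc (A y) _ (G y)⁻¹, Matrix.mul_assoc (A y) _ (G y)⁻¹,
      Matrix.mul_assoc (A y), ← Matrix.mul_sub, Matrix.mul_apply]
  simp only [h4]
  rw [Finset.sum_sub_distrib, Finset.sum_comm (f := fun j i => (A y * covDeriv G i A y * (G y)⁻¹ *
    (christoffelMatrix G j y).transpose) j i)]
  simp [hX]

/-- The two transpositions generate the symmetric group on three letters, and alternating them three
times each is the identity; the accumulated sign is `(-1)³`, so `t = -t`. -/
lemma eq_zero_of_symm_of_skew {t : Fin n → Fin n → Fin n → ℝ} (hs : ∀ d a b, t d a b = t d b a)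
    (ha : ∀ d a b, t d a b = -t b a d) (d a b : Fin n) : t d a b = 0 := by
  have h1 := hs d a b
  have h2 := ha d b a
  have h3 := hs a b d
  have h4 := ha a d b
  have h5 := hs b d a
  have h6 := ha b a d
  linarith

/-- Integrability in terms of the Levi-Civita connection: `∇_{JX} J = J ∇_X J`. -/
lemma covDeriv_of_nijenhuisVanishes (h : IsHermitianOn G A U) (hy : y ∈ U)
    (hN : NijenhuisVanishes A y) (a : Fin n) :
    ∑ m, A y m a • covDeriv G m A y = A y * covDeriv G a A y := by
  set N : Fin n → Matrix (Fin n) (Fin n) ℝ := fun a =>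
    ∑ m, A y m a • covDeriv G m A y - A y * covDeriv G a A y with hNdef
  -- Replacing `∂` by `∇` in the Nijenhuis expression adds Christoffel terms that are together
  -- symmetric in `a` and `b` by torsion-freeness, so the symmetry given by `hN` survives.
  have hsym : ∀ a b c, N a c b = N b c a := by
    have hΓ := h.christoffelMatrix_symm hy
    have e (a b c : Fin n) : N a c b = (∑ m, A y m a * matPderiv m A y c b -
        (A y * matPderiv a A y) c b) +
        (∑ m, A y m a * (christoffelMatrix G m y * A y) c b -
        (∑ m, A y m a * (A y * christoffelMatrix G m y) c b +
          (A y * (christoffelMatrix G a y * A y)) c b) - christoffelMatrix G a y c b) := by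
      have e0 : A y * (A y * christoffelMatrix G a y) = -christoffelMatrix G a y := by
        rw [← Matrix.mul_assoc, h.sq_eq y hy]; simp
      have e1 : christoffelMatrix G a y c b = -(A y * (A y * christoffelMatrix G a y)) c b := by
        rw [e0]; simp
      rw [e1]
      simp only [hNdef, covDeriv, Matrix.sub_apply, Matrix.sum_apply, Matrix.smul_apply,
        Matrix.add_apply, smul_eq_mul, mul_add, mul_sub,
        Finset.sum_add_distrib, Finset.sum_sub_distrib]
      ring
    have s1 (a b c : Fin n) : ∑ m, A y m a * (christoffelMatrix G m y * A y) c b =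
        ∑ m, A y m b * (christoffelMatrix G m y * A y) c a := by
      simp only [Matrix.mul_apply, Finset.mul_sum]
      rw [Finset.sum_comm]
      refine Finset.sum_congr rfl fun m _ => Finset.sum_congr rfl fun l _ => ?_
      rw [hΓ]; ring
    have s2 (a b c : Fin n) : ∑ m, A y m a * (A y * christoffelMatrix G m y) c b =
        (A y * (christoffelMatrix G b y * A y)) c a := by
      rw [← Matrix.mul_assoc, Matrix.mul_apply]
      refine Finset.sum_congr rfl fun m _ => ?_
      rw [mul_comm]
      congr 1
      simp only [Matrix.mul_apply]
      exact Finset.sum_congr rfl fun l _ => by rw [hΓ]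
    intro a b c
    rw [e a b c, e b a c, hN a b c, s1 a b c, s2 a b c, s2 b a c, hΓ a b c]
    ring
  -- Each `N a` is also skew-adjoint. After lowering an index the tensor is symmetric in one pair of
  -- slots and skew in an overlapping pair, hence zero.
  have hskew (a : Fin n) : (N a) * (G y)⁻¹ + (G y)⁻¹ * (N a).transpose = 0 := by
    have hC (m : Fin n) := h.covDeriv_skew h.smooth_complex (fun z hz => h.skew hz) hy m
    have hA' : (G y)⁻¹ * (A y).transpose = -(A y * (G y)⁻¹) :=
      eq_neg_of_add_eq_zero_right (h.skew hy)
    have hC' : (G y)⁻¹ * (covDeriv G a A y).transpose = -(covDeriv G a A y * (G y)⁻¹) :=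
      eq_neg_of_add_eq_zero_right (hC a)
    have e1 : (G y)⁻¹ * (A y * covDeriv G a A y).transpose = -(A y * covDeriv G a A y * (G y)⁻¹) := by
      rw [Matrix.transpose_mul, ← Matrix.mul_assoc, hC', Matrix.neg_mul, Matrix.mul_assoc _ (G y)⁻¹,
        hA', Matrix.mul_neg, neg_neg, h.anticomm hy, Matrix.neg_mul, Matrix.mul_assoc, neg_neg]
    have e2 : (∑ m, A y m a • covDeriv G m A y) * (G y)⁻¹ +
        (G y)⁻¹ * (∑ m, A y m a • covDeriv G m A y).transpose = 0 := by
      rw [Matrix.transpose_sum, Finset.sum_mul, Finset.mul_sum, ← Finset.sum_add_distrib]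
      refine Finset.sum_eq_zero fun m _ => ?_
      rw [Matrix.transpose_smul, Matrix.smul_mul, Matrix.mul_smul, ← smul_add, hC, smul_zero]
    simp only [hNdef, Matrix.transpose_sub, Matrix.sub_mul, Matrix.mul_sub]
    rw [e1, sub_neg_eq_add, sub_add_add_cancel, e2]
  have hlow (a : Fin n) : (G y * N a).transpose = -(G y * N a) := by
    have := congrArg (fun X => G y * X * G y) (hskew a)
    simp only [Matrix.mul_add, Matrix.add_mul, Matrix.mul_zero, Matrix.zero_mul] at this
    rw [Matrix.mul_assoc, Matrix.mul_assoc (N a), h.inv_mul hy, mul_one,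
      ← Matrix.mul_assoc (G y) (G y)⁻¹, h.mul_inv hy, one_mul] at this
    rw [Matrix.transpose_mul, h.symm y hy]
    exact eq_neg_of_add_eq_zero_right this
  have hzero (a : Fin n) : G y * N a = 0 := by
    ext d b
    refine eq_zero_of_symm_of_skew (t := fun d a b => (G y * N a) d b) (fun d a b => ?_)
      (fun d a b => ?_) d a b
    · simp only [Matrix.mul_apply]
      exact Finset.sum_congr rfl fun c _ => by rw [hsym]
    · rw [← Matrix.neg_apply, ← hlow, Matrix.transpose_apply]
  have h0 : N a = 0 := by
    rw [← one_mul (N a), ← h.inv_mul hy, Matrix.mul_assoc, hzero, mul_zero]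
  exact sub_eq_zero.1 h0

/-- The contraction `⟨(∇_bJ) e_a, (∇_aJ) e_b⟩` vanishes for integrable `J`. -/
lemma sum_covDeriv_mul_covDeriv_eq_zero (h : IsHermitianOn G A U) (hy : y ∈ U)
    (hN : NijenhuisVanishes A y) (j : Fin n) :
    ∑ i, (covDeriv G j A y * covDeriv G i A y * (G y)⁻¹) i j = 0 := by
  set C := fun i => covDeriv G i A y with hC
  set H := (G y)⁻¹
  -- Insert `1 = -A²` on the left, move one `A` past `∇_j J` with a sign, and let the other act on
  -- the direction index through `∇_{JX} J = J ∇_X J`. The resulting `A²` returns the original sum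
  -- with the opposite sign.
  have h1 : ∑ i, (C j * C i * H) i j = -∑ i, (C j * C i * H) i j := by
    have hAA (X : Matrix (Fin n) (Fin n) ℝ) : X = -(A y * (A y * X)) := by
      rw [← Matrix.mul_assoc, h.sq_eq y hy]; simp
    have hac : A y * C j = -(C j * A y) := h.anticomm hy j
    calc ∑ i, (C j * C i * H) i j
        = -∑ i, ∑ m, A y i m * (A y * (C j * C i * H)) m j := by
          rw [← Finset.sum_neg_distrib]
          refine Finset.sum_congr rfl fun i _ => ?_
          nth_rewrite 1 [hAA (C j * C i * H)]
          rw [Matrix.neg_apply, Matrix.mul_apply]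
      _ = ∑ i, ∑ m, A y i m * (C j * A y * C i * H) m j := by
          have e (i : Fin n) : A y * (C j * C i * H) = -(C j * A y * C i * H) := by
            rw [← Matrix.mul_assoc, ← Matrix.mul_assoc, hac]; simp [Matrix.mul_assoc]
          simp only [e, Matrix.neg_apply, mul_neg, Finset.sum_neg_distrib, neg_neg]
      _ = ∑ m, (C j * A y * (∑ i, A y i m • C i) * H) m j := by
          rw [Finset.sum_comm]
          refine Finset.sum_congr rfl fun m _ => ?_
          simp only [Finset.mul_sum, Finset.sum_mul, Matrix.sum_apply, Matrix.mul_smul,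
            Matrix.smul_mul, Matrix.smul_apply, smul_eq_mul]
      _ = -∑ i, (C j * C i * H) i j := by
          rw [← Finset.sum_neg_distrib]
          refine Finset.sum_congr rfl fun m _ => ?_
          simp only [hC]
          rw [h.covDeriv_of_nijenhuisVanishes hy hN m, ← Matrix.mul_assoc (_ * A y),
            Matrix.mul_assoc _ (A y) (A y), h.sq_eq y hy]
          simp
  linarith

/-- For integrable `J`, the holomorphic d-scalar curvature is `2 div V + |V|²`, where `V` is the Lee
field and `|V| = |δJ|`. -/
theorem scalar_sub_starScalar_eq (h : IsHermitianOn G A U) (hy : y ∈ U)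
    (hN : NijenhuisVanishes A y) :
    ∑ i, ∑ k, (G y)⁻¹ i k * ricci G i k y - ∑ i, ∑ k, (G y)⁻¹ i k * starRicci G (A y) i k y =
      2 * divergence (density G) (leeField G A) y +
        dotProduct (divJ G A y) ((G y).mulVec (divJ G A y)) := by
  set H := (G y)⁻¹ with hH
  set D := fun i j => covDeriv G i (covDeriv G j A) y with hD
  set C := fun i => covDeriv G i A y with hC
  -- Since `A² = -1`, `A [R, A] = A R A + R`, whose contraction is `Ric - Ric*`; the Ricci identity
  -- replaces `[R, A]` by a commutator of second derivatives.
  have e1 : ∑ i, ∑ k, H i k * ricci G i k y - ∑ i, ∑ k, H i k * starRicci G (A y) i k y =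
      ∑ j, ∑ i, (A y * D j i * H) j i - ∑ j, ∑ i, (A y * D i j * H) j i := by
    have hR (i j : Fin n) : A y * D j i * H - A y * D i j * H =
        (A y * curvMatrix G i j y * A y + curvMatrix G i j y) * H := by
      rw [← Matrix.sub_mul, ← Matrix.mul_sub]
      simp only [hD]
      rw [h.covDeriv_comm h.smooth_complex hy i j, Matrix.mul_sub, ← Matrix.mul_assoc,
        ← Matrix.mul_assoc (A y) (A y), h.sq_eq y hy]
      simp
    have hric (i k : Fin n) : ricci G i k y - starRicci G (A y) i k y =
        ∑ j, (A y * curvMatrix G i j y * A y + curvMatrix G i j y) j k := by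
      simp only [ricci, starRicci, Finset.sum_neg_distrib, sub_neg_eq_add, Matrix.add_apply,
        Finset.sum_add_distrib]
      rw [add_comm]
      congr 1
      refine Finset.sum_congr rfl fun j _ => ?_
      rw [Matrix.mul_assoc, Matrix.mul_apply]
      refine Finset.sum_congr rfl fun l _ => ?_
      rw [Matrix.mul_apply]
      congr 1
      exact Finset.sum_congr rfl fun m _ => mul_comm _ _
    simp only [← Finset.sum_sub_distrib, ← mul_sub, ← Matrix.sub_apply]
    rw [Finset.sum_comm]
    simp only [hR, hric, Finset.mul_sum]
    rw [Finset.sum_comm]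
    have hHs (i k : Fin n) : H i k = H k i := congrFun (congrFun (h.inv_symm hy) k) i
    simp only [Matrix.mul_apply (N := H)]
    have : ∀ i k j, H i k * (A y * curvMatrix G i j y * A y + curvMatrix G i j y) j k =
        (A y * curvMatrix G i j y * A y + curvMatrix G i j y) j k * H k i := fun i k j => by
      rw [hHs, mul_comm]
    simp only [this]
    calc _ = ∑ i, ∑ j, ∑ k, (A y * curvMatrix G i j y * A y + curvMatrix G i j y) j k * H k i :=
          Finset.sum_congr rfl fun i _ => Finset.sum_comm
      _ = _ := Finset.sum_comm
  have hskC (i : Fin n) := h.covDeriv_skew h.smooth_complex (fun z hz => h.skew hz) hy i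
  -- Transposing swaps the matrix indices and, by skewness, turns `A D` into `D A`; moving `A` back
  -- costs the quadratic terms of `covDeriv_anticomm`. Both second-order sums thereby reduce to the
  -- same one.
  have e2 : ∑ j, ∑ i, (A y * D i j * H) j i = -∑ j, ∑ i, (A y * D j i * H) j i -
      ∑ j, ∑ i, (C j * C i * H) j i - ∑ j, ∑ i, (C i * C j * H) j i := by
    rw [Finset.sum_comm]
    simp only [← Finset.sum_neg_distrib, ← Finset.sum_sub_distrib]
    refine Finset.sum_congr rfl fun i _ => Finset.sum_congr rfl fun j _ => ?_
    have hA' : H * (A y).transpose = -(A y * H) :=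
      eq_neg_of_add_eq_zero_right (h.skew hy)
    have hD' : H * (D i j).transpose = -(D i j * H) :=
      eq_neg_of_add_eq_zero_right (h.covDeriv_skew (h.smooth_covDeriv h.smooth_complex j)
        (fun z hz => h.covDeriv_skew h.smooth_complex (fun z hz => h.skew hz) hz j) hy i)
    have t1 : (A y * D i j * H).transpose = D i j * A y * H := by
      rw [Matrix.transpose_mul, Matrix.transpose_mul, h.inv_symm hy, ← Matrix.mul_assoc, hD',
        Matrix.neg_mul, Matrix.mul_assoc, hA', Matrix.mul_neg, neg_neg, Matrix.mul_assoc]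
    have t2 : D i j * A y = -(A y * D i j) - C i * C j - C j * C i := by
      have := h.covDeriv_anticomm hy i j
      rw [← sub_eq_zero, ← this]
      abel
    rw [← Matrix.transpose_apply (A y * D i j * H), t1, t2]
    simp [Matrix.sub_mul]
  have e3 : ∑ j, ∑ i, (C j * C i * H) j i = -(dotProduct (divJ G A y) ((G y).mulVec (divJ G A y))) := by
    rw [← h.sum_covDeriv_mulVec_divJ hy]
    refine Finset.sum_congr rfl fun j _ => ?_
    simp only [Matrix.mulVec, dotProduct, h.divJ_eq hy, Finset.mul_sum, Matrix.mul_assoc]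
    rw [Finset.sum_comm]
    exact Finset.sum_congr rfl fun i _ => Matrix.mul_apply
  have e4 : ∑ j, ∑ i, (C i * C j * H) j i = 0 := by
    rw [Finset.sum_comm]
    exact Finset.sum_eq_zero fun i _ => h.sum_covDeriv_mul_covDeriv_eq_zero hy hN i
  have e5 : ∑ j, ∑ i, (A y * D j i * H) j i = divergence (density G) (leeField G A) y +
        dotProduct (divJ G A y) ((G y).mulVec (divJ G A y)) := h.sum_mul_covDeriv_covDeriv hy
  rw [e1, e2, e3, e4, e5]
  ring

end IsHermitianOn

end LocalIdentity

/-! ### Independence of coordinates for divergence, `δJ` and the Lee field. -/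

section ChangeOfCoordinates

variable {n : ℕ} {G A G' A' : EuclideanSpace ℝ (Fin n) → Matrix (Fin n) (Fin n) ℝ}
  {U U' : Set (EuclideanSpace ℝ (Fin n))} {y : EuclideanSpace ℝ (Fin n)}
  {Φ : EuclideanSpace ℝ (Fin n) → EuclideanSpace ℝ (Fin n)}

/-- The Jacobian matrix of a map between Euclidean spaces. -/
def jacobian (Φ : EuclideanSpace ℝ (Fin n) → EuclideanSpace ℝ (Fin n))
    (y : EuclideanSpace ℝ (Fin n)) : Matrix (Fin n) (Fin n) ℝ :=
  Matrix.of fun k i => pderiv i (fun z => Φ z k) y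

/-- `Φ` is a local diffeomorphism from `U` to `U'` which intertwines the almost Hermitian data
`(G, A)` and `(G', A')`. -/
structure IsTransition (Φ : EuclideanSpace ℝ (Fin n) → EuclideanSpace ℝ (Fin n))
    (G A G' A' : EuclideanSpace ℝ (Fin n) → Matrix (Fin n) (Fin n) ℝ)
    (U U' : Set (EuclideanSpace ℝ (Fin n))) : Prop where
  smooth : ContDiffOn ℝ ∞ Φ U
  mapsTo : Set.MapsTo Φ U U'
  det_ne : ∀ z ∈ U, (jacobian Φ z).det ≠ 0
  metric : ∀ z ∈ U, G z = (jacobian Φ z).transpose * G' (Φ z) * jacobian Φ z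
  complex : ∀ z ∈ U, A' (Φ z) * jacobian Φ z = jacobian Φ z * A z

lemma sqrt_det_transpose_mul_mul {F B B' : Matrix (Fin n) (Fin n) ℝ}
    (h : B = F.transpose * B' * F) : Real.sqrt B.det = |F.det| * Real.sqrt B'.det := by
  rw [h, Matrix.det_mul, Matrix.det_mul, Matrix.det_transpose,
    show ∀ a b : ℝ, a * b * a = a ^ 2 * b from fun a b => by ring, Real.sqrt_mul (sq_nonneg _),
    Real.sqrt_sq_eq_abs]

lemma IsHermitianOn.mono {V : Set (EuclideanSpace ℝ (Fin n))} (h : IsHermitianOn G A U)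
    (hV : IsOpen V) (hVU : V ⊆ U) : IsHermitianOn G A V where
  isOpen := hV
  smooth_metric a b := (h.smooth_metric a b).mono hVU
  smooth_complex a b := (h.smooth_complex a b).mono hVU
  symm z hz := h.symm z (hVU hz)
  det_pos z hz := h.det_pos z (hVU hz)
  sq_eq z hz := h.sq_eq z (hVU hz)
  compat z hz := h.compat z (hVU hz)

lemma divergence_eq_sum {ρ : EuclideanSpace ℝ (Fin n) → ℝ}
    {X : EuclideanSpace ℝ (Fin n) → Fin n → ℝ} (hρ : DifferentiableAt ℝ ρ y) (hρ0 : ρ y ≠ 0)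
    (hX : ∀ k, DifferentiableAt ℝ (fun z => X z k) y) :
    divergence ρ X y = ∑ k, (pderiv k (fun z => X z k) y + X y k * (pderiv k ρ y / ρ y)) := by
  rw [divergence, Finset.sum_div]
  refine Finset.sum_congr rfl fun k _ => ?_
  rw [pderiv_mul hρ (hX k)]
  field_simp
  ring

lemma divergence_congr {ρ : EuclideanSpace ℝ (Fin n) → ℝ}
    {X Y : EuclideanSpace ℝ (Fin n) → Fin n → ℝ} (hXY : X =ᶠ[nhds y] Y) :
    divergence ρ X y = divergence ρ Y y := by
  unfold divergence
  congr 1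
  exact Finset.sum_congr rfl fun k _ => pderiv_congr (hXY.mono fun z hz => by simp only [hz])

lemma divergence_sum {ι : Type*} {s : Finset ι} {ρ : EuclideanSpace ℝ (Fin n) → ℝ}
    {X : ι → EuclideanSpace ℝ (Fin n) → Fin n → ℝ} (hρ : DifferentiableAt ℝ ρ y)
    (hX : ∀ i ∈ s, ∀ k, DifferentiableAt ℝ (fun z => X i z k) y) :
    divergence ρ (fun z k => ∑ i ∈ s, X i z k) y = ∑ i ∈ s, divergence ρ (X i) y := by
  unfold divergence
  rw [← Finset.sum_div, Finset.sum_comm]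
  congr 1
  refine Finset.sum_congr rfl fun k _ => ?_
  simp only [Finset.mul_sum]
  exact pderiv_sum fun i hi => hρ.fun_mul (hX i hi k)

namespace IsTransition

lemma smooth_apply (hT : IsTransition Φ G A G' A' U U') (k : Fin n) :
    ContDiffOn ℝ ∞ (fun z => Φ z k) U :=
  (EuclideanSpace.proj (𝕜 := ℝ) k).contDiff.comp_contDiffOn hT.smooth

lemma smooth_jacobian (hT : IsTransition Φ G A G' A' U U') (hU : IsOpen U) :
    MatSmoothOn (jacobian Φ) U :=
  fun k i => contDiffOn_pderiv hU (hT.smooth_apply k) i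

lemma differentiableAt (hT : IsTransition Φ G A G' A' U U') (hU : IsOpen U) (hy : y ∈ U) :
    DifferentiableAt ℝ Φ y :=
  (hT.smooth.differentiableOn (by simp)).differentiableAt (hU.mem_nhds hy)

lemma density_eq (hT : IsTransition Φ G A G' A' U U') (hy : y ∈ U) :
    density G y = |(jacobian Φ y).det| * density G' (Φ y) :=
  sqrt_det_transpose_mul_mul (hT.metric y hy)

/-- The logarithmic derivative of `ρ = |det dΦ| · (ρ' ∘ Φ)`. The absolute value is needed because
transition maps may reverse orientation. -/
lemma pderiv_density_div (hT : IsTransition Φ G A G' A' U U') (h : IsHermitianOn G A U)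
    (h' : IsHermitianOn G' A' U') (hy : y ∈ U) (i : Fin n) :
    pderiv i (density G) y / density G y = ((jacobian Φ y)⁻¹ * matPderiv i (jacobian Φ) y).trace +
      ∑ k, jacobian Φ y k i * (pderiv k (density G') (Φ y) / density G' (Φ y)) := by
  have hy' := hT.mapsTo hy
  have hdet := hT.det_ne y hy
  have hρ' := differentiableAt_of_contDiffOn h'.isOpen h'.smooth_density hy'
  have hΦ := hT.differentiableAt h.isOpen hy
  have hd := differentiableAt_of_contDiffOn h.isOpen (hT.smooth_jacobian h.isOpen).det hy
  have habs := (hasDerivAt_abs hdet).comp_hasFDerivAt y hd.hasFDerivAt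
  have h1 : pderiv i (fun z => |(jacobian Φ z).det|) y =
      |(jacobian Φ y).det| * ((jacobian Φ y)⁻¹ * matPderiv i (jacobian Φ) y).trace := by
    have := pderiv_det (i := i) h.isOpen (hT.smooth_jacobian h.isOpen) hdet hy
    rw [pderiv, show (fun z => |(jacobian Φ z).det|) = (fun x => |x|) ∘ fun z =>
      (jacobian Φ z).det from rfl, habs.fderiv, smul_apply, smul_eq_mul,
      ← sign_mul_self (jacobian Φ y).det, mul_assoc, ← this]
    rfl
  rw [pderiv_congr (Filter.eventually_of_mem (h.isOpen.mem_nhds hy) fun z hz => hT.density_eq hz),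
    pderiv_mul (f := fun z => |(jacobian Φ z).det|) (h := fun z => density G' (Φ z))
      habs.differentiableAt (hρ'.comp y hΦ), h1, pderiv_comp hρ' hΦ, hT.density_eq hy]
  have hpos := (h'.density_pos hy').ne'
  have hpos2 := abs_ne_zero.2 hdet
  simp only [← mul_div_assoc]
  rw [← Finset.sum_div, Finset.mul_sum, ← Finset.mul_sum]
  have hjac (k : Fin n) : pderiv i (fun z => Φ z k) y = jacobian Φ y k i := rfl
  simp only [hjac]
  field_simp

/-- The divergence does not depend on the coordinates. -/
lemma divergence_eq (hT : IsTransition Φ G A G' A' U U') (h : IsHermitianOn G A U)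
    (h' : IsHermitianOn G' A' U') (hy : y ∈ U) {X X' : EuclideanSpace ℝ (Fin n) → Fin n → ℝ}
    (hX : ∀ k, ContDiffOn ℝ ∞ (fun z => X z k) U) (hX' : ∀ k, ContDiffOn ℝ ∞ (fun z => X' z k) U')
    (hXX' : ∀ z ∈ U, X' (Φ z) = (jacobian Φ z).mulVec (X z)) :
    divergence (density G') X' (Φ y) = divergence (density G) X y := by
  have hy' := hT.mapsTo hy
  have hdet := hT.det_ne y hy
  have hJ := hT.smooth_jacobian h.isOpen
  have hXd := fun k => differentiableAt_of_contDiffOn h.isOpen (hX k) hy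
  have hXd' := fun k => differentiableAt_of_contDiffOn h'.isOpen (hX' k) hy'
  rw [divergence_eq_sum (differentiableAt_of_contDiffOn h'.isOpen h'.smooth_density hy')
    (h'.density_pos hy').ne' hXd', divergence_eq_sum (differentiableAt_of_contDiffOn h.isOpen
    h.smooth_density hy) (h.density_pos hy).ne' hXd]
  set F := jacobian Φ y with hF
  set B' : Matrix (Fin n) (Fin n) ℝ := Matrix.of fun k l => pderiv l (fun z => X' z k) (Φ y)
  set B : Matrix (Fin n) (Fin n) ℝ := Matrix.of fun k l => pderiv l (fun z => X z k) y
  set Z : Matrix (Fin n) (Fin n) ℝ :=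
    Matrix.of fun k i => ∑ j, matPderiv i (jacobian Φ) y k j * X y j with hZ
  have hFF : F * F⁻¹ = 1 := Matrix.mul_nonsing_inv _ (isUnit_iff_ne_zero.2 hdet)
  have hFF' : F⁻¹ * F = 1 := Matrix.nonsing_inv_mul _ (isUnit_iff_ne_zero.2 hdet)
  have h1 : B' * F = Z + F * B := by
    ext k i
    have e1 : pderiv i (fun z => X' (Φ z) k) y = (B' * F) k i := by
      rw [pderiv_comp (f := fun z => X' z k) (hXd' k) (hT.differentiableAt h.isOpen hy),
        Matrix.mul_apply]
      exact Finset.sum_congr rfl fun l _ => mul_comm _ _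
    have e2 : pderiv i (fun z => X' (Φ z) k) y = (Z + F * B) k i := by
      rw [pderiv_congr (h := fun z => ∑ j, jacobian Φ z k j * X z j)
        (Filter.eventually_of_mem (h.isOpen.mem_nhds hy) fun z hz => by rw [hXX' z hz]; rfl),
        pderiv_sum fun j _ => (hJ.differentiableAt h.isOpen hy k j).fun_mul (hXd j),
        Matrix.add_apply, Matrix.mul_apply, hZ, Matrix.of_apply, ← Finset.sum_add_distrib]
      exact Finset.sum_congr rfl fun j _ =>
        pderiv_mul (hJ.differentiableAt h.isOpen hy k j) (hXd j)
    rw [← e1, e2]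
  have h2 : B'.trace = (F⁻¹ * Z).trace + B.trace := by
    rw [← mul_one B', ← hFF, ← Matrix.mul_assoc, h1, Matrix.add_mul, Matrix.trace_add,
      Matrix.trace_mul_comm, Matrix.trace_mul_comm (F * B), ← Matrix.mul_assoc, hFF', one_mul]
  -- `Z` collects the second derivatives of `Φ`. Their symmetry turns this trace into the derivative
  -- of `log |det dΦ|` along `X`, exactly the term by which the two densities differ.
  have h3 : (F⁻¹ * Z).trace = ∑ j, X y j * (F⁻¹ * matPderiv j (jacobian Φ) y).trace := by
    have hcomm (i j k : Fin n) : matPderiv i (jacobian Φ) y k j = matPderiv j (jacobian Φ) y k i :=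
      pderiv_comm h.isOpen (hT.smooth_apply k) hy i j
    simp only [Matrix.trace, Matrix.diag, Matrix.mul_apply, hZ, Matrix.of_apply, Finset.mul_sum]
    calc _ = ∑ i, ∑ j, ∑ k, X y j * (F⁻¹ i k * matPderiv j (jacobian Φ) y k i) := by
          refine Finset.sum_congr rfl fun i _ => ?_
          rw [Finset.sum_comm]
          refine Finset.sum_congr rfl fun j _ => Finset.sum_congr rfl fun k _ => ?_
          rw [hcomm]; ring
      _ = _ := Finset.sum_comm
  have h4 : ∑ k, X' (Φ y) k * (pderiv k (density G') (Φ y) / density G' (Φ y)) =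
      ∑ j, X y j * ∑ k, F k j * (pderiv k (density G') (Φ y) / density G' (Φ y)) := by
    rw [hXX' y hy]
    simp only [Matrix.mulVec, dotProduct, Finset.sum_mul, Finset.mul_sum]
    rw [Finset.sum_comm]
    exact Finset.sum_congr rfl fun j _ => Finset.sum_congr rfl fun k _ => by ring
  rw [Finset.sum_add_distrib, Finset.sum_add_distrib, h4]
  simp only [hT.pderiv_density_div h h' hy, mul_add, Finset.sum_add_distrib]
  rw [← h3]
  have h5 : ∑ k, pderiv k (fun z => X' z k) (Φ y) = B'.trace := rfl
  have h6 : ∑ k, pderiv k (fun z => X z k) y = B.trace := rfl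
  rw [h5, h6, h2]
  ring

lemma inv_eq (hT : IsTransition Φ G A G' A' U U') (hy : y ∈ U) :
    (G' (Φ y))⁻¹ = jacobian Φ y * (G y)⁻¹ * (jacobian Φ y).transpose := by
  have hu : IsUnit (jacobian Φ y).det := isUnit_iff_ne_zero.2 (hT.det_ne y hy)
  have hu' : IsUnit (jacobian Φ y).transpose.det := by rwa [Matrix.det_transpose]
  rw [hT.metric y hy, Matrix.mul_inv_rev, Matrix.mul_inv_rev, ← Matrix.mul_assoc,
    Matrix.mul_nonsing_inv _ hu, one_mul, Matrix.mul_assoc, Matrix.nonsing_inv_mul _ hu', mul_one]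

/-- The bivector `P = A G⁻¹` transforms to `F P Fᵀ`, so a row of the new bivector is the pushforward
of the corresponding row of `F P` and divergence invariance applies. The derivatives of `F` are
symmetric second derivatives of `Φ` and vanish against the antisymmetric `P`. -/
lemma divJ_eq (hT : IsTransition Φ G A G' A' U U') (h : IsHermitianOn G A U)
    (h' : IsHermitianOn G' A' U') (hy : y ∈ U) :
    divJ G' A' (Φ y) = (jacobian Φ y).mulVec (divJ G A y) := by
  funext k
  have hJ := hT.smooth_jacobian h.isOpen
  have hP := h.smooth_complex.mul h.smooth_inv
  have hρ := differentiableAt_of_contDiffOn h.isOpen h.smooth_density hy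
  have h1 : divJ G' A' (Φ y) k =
      divergence (density G) (fun z => (jacobian Φ z * (A z * (G z)⁻¹)) k) y := by
    refine hT.divergence_eq h h' hy (fun b => hJ.mul hP k b)
      (fun b => h'.smooth_complex.mul h'.smooth_inv k b) fun z hz => ?_
    have : A' (Φ z) * (G' (Φ z))⁻¹ =
        jacobian Φ z * (A z * (G z)⁻¹) * (jacobian Φ z).transpose := by
      rw [hT.inv_eq hz, ← Matrix.mul_assoc, ← Matrix.mul_assoc, hT.complex z hz, Matrix.mul_assoc _
        (A z)]
    rw [this]
    funext b
    simp only [Matrix.mul_apply (M := jacobian Φ z * _), Matrix.mulVec, dotProduct,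
      Matrix.transpose_apply]
    exact Finset.sum_congr rfl fun j _ => mul_comm _ _
  have hskew := h.transpose_mul_inv hy (h.skew hy)
  have h2 : ∑ b, ∑ j, matPderiv b (jacobian Φ) y k j * (A y * (G y)⁻¹) j b = 0 := by
    have : ∑ b, ∑ j, matPderiv b (jacobian Φ) y k j * (A y * (G y)⁻¹) j b =
        -∑ b, ∑ j, matPderiv b (jacobian Φ) y k j * (A y * (G y)⁻¹) j b := by
      conv_rhs => rw [Finset.sum_comm]
      simp only [← Finset.sum_neg_distrib]
      refine Finset.sum_congr rfl fun b _ => Finset.sum_congr rfl fun j _ => ?_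
      rw [show matPderiv b (jacobian Φ) y k j = matPderiv j (jacobian Φ) y k b from
        pderiv_comm h.isOpen (hT.smooth_apply k) hy b j, ← mul_neg, ← Matrix.neg_apply, ← hskew,
        Matrix.transpose_apply]
    linarith
  rw [h1, divergence_eq_sum hρ (h.density_pos hy).ne'
    (fun b => (hJ.mul hP).differentiableAt h.isOpen hy k b)]
  simp only [Matrix.mulVec, dotProduct, divJ]
  have h3 (j : Fin n) := divergence_eq_sum hρ (h.density_pos hy).ne'
    (X := fun z => (A z * (G z)⁻¹) j) (fun b => hP.differentiableAt h.isOpen hy j b)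
  simp only [h3, Finset.mul_sum]
  rw [Finset.sum_comm, ← add_zero (∑ b, ∑ j, _), ← h2, ← Finset.sum_add_distrib]
  refine Finset.sum_congr rfl fun b _ => ?_
  have h4 : pderiv b (fun z => (jacobian Φ z * (A z * (G z)⁻¹)) k b) y =
      (matPderiv b (jacobian Φ) y * (A y * (G y)⁻¹) +
        jacobian Φ y * matPderiv b (fun z => A z * (G z)⁻¹) y) k b :=
    congrFun (congrFun (matPderiv_mul h.isOpen hJ hP hy) k) b
  rw [h4, Matrix.add_apply, Matrix.mul_apply, Matrix.mul_apply, Matrix.mul_apply (M := jacobian Φ y),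
    Finset.sum_mul, ← Finset.sum_add_distrib, ← Finset.sum_add_distrib, ← Finset.sum_add_distrib]
  refine Finset.sum_congr rfl fun j _ => ?_
  simp only [matPderiv, Matrix.of_apply]
  ring

lemma leeField_eq (hT : IsTransition Φ G A G' A' U U') (h : IsHermitianOn G A U)
    (h' : IsHermitianOn G' A' U') (hy : y ∈ U) :
    leeField G' A' (Φ y) = (jacobian Φ y).mulVec (leeField G A y) := by
  rw [leeField, leeField, hT.divJ_eq h h' hy, Matrix.mulVec_mulVec, Matrix.mulVec_mulVec,
    hT.complex y hy]

/-- The divergence of a multiple of the Lee field does not depend on the coordinates. -/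
lemma divergence_smul_leeField_eq (hT : IsTransition Φ G A G' A' U U') (h : IsHermitianOn G A U)
    (h' : IsHermitianOn G' A' U') (hy : y ∈ U) {ψ ψ' : EuclideanSpace ℝ (Fin n) → ℝ}
    (hψ : ContDiffOn ℝ ∞ ψ U) (hψ' : ContDiffOn ℝ ∞ ψ' U') (hψψ' : ∀ z ∈ U, ψ' (Φ z) = ψ z) :
    divergence (density G') (fun z k => ψ' z * leeField G' A' z k) (Φ y) =
      divergence (density G) (fun z k => ψ z * leeField G A z k) y :=
  hT.divergence_eq h h' hy (fun k => hψ.mul (h.contDiffOn_leeField k))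
    (fun k => hψ'.mul (h'.contDiffOn_leeField k)) fun z hz => by
      rw [hψψ' z hz, hT.leeField_eq h h' hz]
      exact (Matrix.mulVec_smul _ (ψ z) (leeField G A z)).symm

end IsTransition

end ChangeOfCoordinates

/-! ### Coordinate expressions of `g` and `J`, and transition maps. -/

section Charts

variable {n : ℕ} {M : Type*} [TopologicalSpace M] [ChartedSpace (EuclideanSpace ℝ (Fin n)) M]

/-- The metric at `p`, on the model space. -/
def metricAt [IsManifold (𝓡 n) ∞ M] (g : RiemannianMetric n M) (p : M) :
    EuclideanSpace ℝ (Fin n) →L[ℝ] EuclideanSpace ℝ (Fin n) →L[ℝ] ℝ :=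
  g.inner p

/-- The almost complex structure at `p`, on the model space. -/
def complexAt [IsManifold (𝓡 n) ∞ M] (J : AlmostComplexStructure n M) (p : M) :
    EuclideanSpace ℝ (Fin n) →L[ℝ] EuclideanSpace ℝ (Fin n) :=
  J.toFun p

/-- The derivative of the chart at `c`. -/
def chartDeriv (c p : M) : EuclideanSpace ℝ (Fin n) →L[ℝ] EuclideanSpace ℝ (Fin n) :=
  mfderiv (𝓡 n) 𝓘(ℝ, EuclideanSpace ℝ (Fin n)) (extChartAt (𝓡 n) c) p

/-- The derivative of the inverse of the chart at `c`. -/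
def chartSymmDeriv (c : M) (y : EuclideanSpace ℝ (Fin n)) :
    EuclideanSpace ℝ (Fin n) →L[ℝ] EuclideanSpace ℝ (Fin n) :=
  mfderiv 𝓘(ℝ, EuclideanSpace ℝ (Fin n)) (𝓡 n) (extChartAt (𝓡 n) c).symm y

lemma isOpen_target (c : M) : IsOpen (extChartAt (𝓡 n) c).target :=
  isOpen_extChartAt_target c

/-- The transition map between two charts. -/
def transition (c d : M) (y : EuclideanSpace ℝ (Fin n)) : EuclideanSpace ℝ (Fin n) :=
  extChartAt (𝓡 n) d ((extChartAt (𝓡 n) c).symm y)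

/-- The coordinates in the chart at `c` of the points which also lie in the chart at `d`. -/
def overlap (n : ℕ) {M : Type*} [TopologicalSpace M] [ChartedSpace (EuclideanSpace ℝ (Fin n)) M]
    (c d : M) : Set (EuclideanSpace ℝ (Fin n)) :=
  (extChartAt (𝓡 n) c).target ∩ (extChartAt (𝓡 n) c).symm ⁻¹' (extChartAt (𝓡 n) d).source

lemma isOpen_overlap (c d : M) : IsOpen (overlap n c d) :=
  (continuousOn_extChartAt_symm c).isOpen_inter_preimage (isOpen_target c)
    (isOpen_extChartAt_source d)

lemma symm_transition {c d : M} {y : EuclideanSpace ℝ (Fin n)} (hy : y ∈ overlap n c d) :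
    (extChartAt (𝓡 n) d).symm (transition c d y) = (extChartAt (𝓡 n) c).symm y :=
  (extChartAt (𝓡 n) d).left_inv hy.2

lemma transition_mem_target {c d : M} {y : EuclideanSpace ℝ (Fin n)} (hy : y ∈ overlap n c d) :
    transition c d y ∈ (extChartAt (𝓡 n) d).target :=
  (extChartAt (𝓡 n) d).map_source hy.2

lemma transition_transition {c d : M} {y : EuclideanSpace ℝ (Fin n)} (hy : y ∈ overlap n c d) :
    transition d c (transition c d y) = y := by
  rw [transition, symm_transition hy, (extChartAt (𝓡 n) c).right_inv hy.1]

variable [IsManifold (𝓡 n) ∞ M]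

lemma chartDeriv_chartSymmDeriv {c : M} {y : EuclideanSpace ℝ (Fin n)}
    (hy : y ∈ (extChartAt (𝓡 n) c).target) (v : EuclideanSpace ℝ (Fin n)) :
    chartDeriv c ((extChartAt (𝓡 n) c).symm y) (chartSymmDeriv c y v) = v := by
  have : IsManifold (𝓡 n) 1 M := .of_le (n := ∞) (by simp)
  have := mfderiv_extChartAt_comp_mfderivWithin_extChartAt_symm (I := 𝓡 n) hy
  rw [ModelWithCorners.range_eq_univ, mfderivWithin_univ] at this
  exact congrArg (fun f => f v) this

lemma chartSymmDeriv_chartDeriv {c : M} {y : EuclideanSpace ℝ (Fin n)}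
    (hy : y ∈ (extChartAt (𝓡 n) c).target) (v : EuclideanSpace ℝ (Fin n)) :
    chartSymmDeriv c y (chartDeriv c ((extChartAt (𝓡 n) c).symm y) v) = v := by
  have : IsManifold (𝓡 n) 1 M := .of_le (n := ∞) (by simp)
  have := mfderivWithin_extChartAt_symm_comp_mfderiv_extChartAt (I := 𝓡 n) hy
  rw [ModelWithCorners.range_eq_univ, mfderivWithin_univ] at this
  exact congrArg (fun f => f v) this

lemma contMDiffOn_symm (c : M) : ContMDiffOn 𝓘(ℝ, EuclideanSpace ℝ (Fin n)) (𝓡 n) ∞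
    (extChartAt (𝓡 n) c).symm (extChartAt (𝓡 n) c).target :=
  contMDiffOn_extChartAt_symm c

lemma mdifferentiableAt_symm {c : M} {y : EuclideanSpace ℝ (Fin n)}
    (hy : y ∈ (extChartAt (𝓡 n) c).target) :
    MDifferentiableAt 𝓘(ℝ, EuclideanSpace ℝ (Fin n)) (𝓡 n) (extChartAt (𝓡 n) c).symm y :=
  ((contMDiffOn_symm c).mdifferentiableOn (by simp)).mdifferentiableAt
    ((isOpen_target c).mem_nhds hy)

/-- The coordinate vector fields are smooth. -/
lemma contMDiffOn_chartSymmDeriv (c : M) (v : EuclideanSpace ℝ (Fin n)) :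
    ContMDiffOn 𝓘(ℝ, EuclideanSpace ℝ (Fin n)) ((𝓡 n).prod 𝓘(ℝ, EuclideanSpace ℝ (Fin n))) ∞
      (fun y => Bundle.TotalSpace.mk' (EuclideanSpace ℝ (Fin n))
        (E := fun x : M => TangentSpace (𝓡 n) x) ((extChartAt (𝓡 n) c).symm y)
        (chartSymmDeriv c y v)) (extChartAt (𝓡 n) c).target := by
  have : IsManifold (𝓡 n) 1 M := .of_le (n := ∞) (by simp)
  have ho := isOpen_target (n := n) c
  have h1 := (contMDiffOn_symm c).contMDiffOn_tangentMapWithin (m := ∞) (by simp)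
    ho.uniqueMDiffOn
  have h2 : ContMDiff 𝓘(ℝ, EuclideanSpace ℝ (Fin n))
      (𝓘(ℝ, EuclideanSpace ℝ (Fin n)).prod 𝓘(ℝ, EuclideanSpace ℝ (Fin n))) ∞
      (fun y : EuclideanSpace ℝ (Fin n) => (⟨y, v⟩ :
        TangentBundle 𝓘(ℝ, EuclideanSpace ℝ (Fin n)) (EuclideanSpace ℝ (Fin n)))) :=
    contMDiff_vectorSpace_iff_contDiff.2 contDiff_const
  refine (h1.comp h2.contMDiffOn fun y hy => hy).congr fun y hy => ?_
  simp only [tangentMapWithin, Function.comp]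
  rw [mfderivWithin_of_isOpen ho hy]
  rfl

variable {g : RiemannianMetric n M} {J : AlmostComplexStructure n M}

lemma contDiffOn_metricAt (g : RiemannianMetric n M) {c : M}
    {v w : EuclideanSpace ℝ (Fin n) → EuclideanSpace ℝ (Fin n)}
    (hv : ContMDiffOn 𝓘(ℝ, EuclideanSpace ℝ (Fin n))
      ((𝓡 n).prod 𝓘(ℝ, EuclideanSpace ℝ (Fin n))) ∞
      (fun y => Bundle.TotalSpace.mk' (EuclideanSpace ℝ (Fin n))
        (E := fun x : M => TangentSpace (𝓡 n) x) ((extChartAt (𝓡 n) c).symm y)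
        (v y)) (extChartAt (𝓡 n) c).target)
    (hw : ContMDiffOn 𝓘(ℝ, EuclideanSpace ℝ (Fin n))
      ((𝓡 n).prod 𝓘(ℝ, EuclideanSpace ℝ (Fin n))) ∞
      (fun y => Bundle.TotalSpace.mk' (EuclideanSpace ℝ (Fin n))
        (E := fun x : M => TangentSpace (𝓡 n) x) ((extChartAt (𝓡 n) c).symm y)
        (w y)) (extChartAt (𝓡 n) c).target) :
    ContDiffOn ℝ ∞ (fun y => metricAt g ((extChartAt (𝓡 n) c).symm y) (v y) (w y))
      (extChartAt (𝓡 n) c).target := by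
  rw [← contMDiffOn_iff_contDiffOn]
  intro y hy
  have : ContMDiffWithinAt 𝓘(ℝ, EuclideanSpace ℝ (Fin n)) ((𝓡 n).prod 𝓘(ℝ)) ∞
      (fun y => Bundle.TotalSpace.mk' ℝ (E := Bundle.Trivial M ℝ) ((extChartAt (𝓡 n) c).symm y)
        (metricAt g ((extChartAt (𝓡 n) c).symm y) (v y) (w y)))
      (extChartAt (𝓡 n) c).target y := by
    apply ContMDiffWithinAt.clm_bundle_apply₂ (F₁ := EuclideanSpace ℝ (Fin n))
      (F₂ := EuclideanSpace ℝ (Fin n)) (E₁ := fun x : M => TangentSpace (𝓡 n) x)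
      (E₂ := fun x : M => TangentSpace (𝓡 n) x)
    · exact ContMDiffAt.comp_contMDiffWithinAt y g.contMDiff.contMDiffAt (contMDiffOn_symm c y hy)
    · exact hv y hy
    · exact hw y hy
  simp only [Bundle.contMDiffWithinAt_totalSpace] at this
  exact this.2

lemma contMDiffOn_complexAt (J : AlmostComplexStructure n M) {c : M}
    {v : EuclideanSpace ℝ (Fin n) → EuclideanSpace ℝ (Fin n)}
    (hv : ContMDiffOn 𝓘(ℝ, EuclideanSpace ℝ (Fin n))
      ((𝓡 n).prod 𝓘(ℝ, EuclideanSpace ℝ (Fin n))) ∞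
      (fun y => Bundle.TotalSpace.mk' (EuclideanSpace ℝ (Fin n))
        (E := fun x : M => TangentSpace (𝓡 n) x) ((extChartAt (𝓡 n) c).symm y)
        (v y)) (extChartAt (𝓡 n) c).target) :
    ContMDiffOn 𝓘(ℝ, EuclideanSpace ℝ (Fin n))
      ((𝓡 n).prod 𝓘(ℝ, EuclideanSpace ℝ (Fin n))) ∞
      (fun y => Bundle.TotalSpace.mk' (EuclideanSpace ℝ (Fin n))
        (E := fun x : M => TangentSpace (𝓡 n) x) ((extChartAt (𝓡 n) c).symm y)
        (complexAt J ((extChartAt (𝓡 n) c).symm y) (v y))) (extChartAt (𝓡 n) c).target :=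
  fun y hy => ContMDiffWithinAt.clm_bundle_apply (F₁ := EuclideanSpace ℝ (Fin n))
    (F₂ := EuclideanSpace ℝ (Fin n)) (E₁ := fun x : M => TangentSpace (𝓡 n) x)
    (E₂ := fun x : M => TangentSpace (𝓡 n) x)
    (ContMDiffAt.comp_contMDiffWithinAt y J.contMDiff.contMDiffAt (contMDiffOn_symm c y hy))
    (hv y hy)

lemma gram_apply (g : RiemannianMetric n M) (c : M) (y : EuclideanSpace ℝ (Fin n)) (i j : Fin n) :
    gram g c y i j = metricAt g ((extChartAt (𝓡 n) c).symm y)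
      (chartSymmDeriv c y (EuclideanSpace.single i 1))
      (chartSymmDeriv c y (EuclideanSpace.single j 1)) := rfl

lemma jMatrix_apply (J : AlmostComplexStructure n M) (c : M) (y : EuclideanSpace ℝ (Fin n))
    (i j : Fin n) : jMatrix J c y i j = chartDeriv c ((extChartAt (𝓡 n) c).symm y)
      (complexAt J ((extChartAt (𝓡 n) c).symm y)
        (chartSymmDeriv c y (EuclideanSpace.single j 1))) i := rfl

lemma sum_single (v : EuclideanSpace ℝ (Fin n)) :
    v = ∑ k, v k • EuclideanSpace.single k (1 : ℝ) := by
  ext j; simp [Pi.single_apply]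

lemma metricAt_chartSymmDeriv (g : RiemannianMetric n M) (c : M) (y v w : EuclideanSpace ℝ (Fin n)) :
    metricAt g ((extChartAt (𝓡 n) c).symm y) (chartSymmDeriv c y v) (chartSymmDeriv c y w) =
      dotProduct v ((gram g c y).mulVec w) := by
  conv_lhs => rw [sum_single v, sum_single w]
  simp only [map_sum, map_smul, _root_.sum_apply, _root_.smul_apply, smul_eq_mul,
    dotProduct, Matrix.mulVec, Finset.mul_sum, gram_apply]
  rw [Finset.sum_comm]
  exact Finset.sum_congr rfl fun i _ => Finset.sum_congr rfl fun j _ => by ring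

lemma complexAt_chartSymmDeriv (J : AlmostComplexStructure n M) {c : M}
    {y : EuclideanSpace ℝ (Fin n)} (hy : y ∈ (extChartAt (𝓡 n) c).target)
    (v : EuclideanSpace ℝ (Fin n)) :
    complexAt J ((extChartAt (𝓡 n) c).symm y) (chartSymmDeriv c y v) =
      chartSymmDeriv c y (WithLp.toLp 2 ((jMatrix J c y).mulVec v)) := by
  rw [← chartSymmDeriv_chartDeriv hy (complexAt J _ _)]
  congr 1
  conv_lhs => rw [sum_single v]
  ext i
  simp only [map_sum, map_smul, Matrix.mulVec, dotProduct, jMatrix_apply,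
    WithLp.ofLp_sum, Finset.sum_apply, WithLp.ofLp_smul, Pi.smul_apply, smul_eq_mul]
  exact Finset.sum_congr rfl fun j _ => mul_comm _ _

lemma complexAt_sq (J : AlmostComplexStructure n M) (p : M) (v : EuclideanSpace ℝ (Fin n)) :
    complexAt J p (complexAt J p v) = -v := J.sq_eq_neg p v

lemma metricAt_symm (g : RiemannianMetric n M) (p : M) (v w : EuclideanSpace ℝ (Fin n)) :
    metricAt g p v w = metricAt g p w v := g.symm p v w

lemma metricAt_pos (g : RiemannianMetric n M) (p : M) {v : EuclideanSpace ℝ (Fin n)} (hv : v ≠ 0) :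
    0 < metricAt g p v v := g.pos p v hv

lemma chartSymmDeriv_injective {c : M} {y : EuclideanSpace ℝ (Fin n)}
    (hy : y ∈ (extChartAt (𝓡 n) c).target) : Function.Injective (chartSymmDeriv c y) :=
  Function.LeftInverse.injective (chartDeriv_chartSymmDeriv hy)

lemma gram_posDef (g : RiemannianMetric n M) {c : M} {y : EuclideanSpace ℝ (Fin n)}
    (hy : y ∈ (extChartAt (𝓡 n) c).target) : (gram g c y).PosDef := by
  refine Matrix.PosDef.of_dotProduct_mulVec_pos ?_ fun v hv => ?_
  · ext i j
    rw [Matrix.conjTranspose_apply, gram_apply, gram_apply, metricAt_symm]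
    rfl
  · have h := metricAt_chartSymmDeriv g c y (WithLp.toLp 2 v) (WithLp.toLp 2 v)
    rw [star_trivial]
    refine h ▸ metricAt_pos g _ fun h0 => hv ?_
    have := chartSymmDeriv_injective hy (h0.trans (map_zero _).symm)
    simpa using this

lemma contDiffOn_gram (g : RiemannianMetric n M) (c : M) :
    MatSmoothOn (gram g c) (extChartAt (𝓡 n) c).target := fun _ _ =>
  contDiffOn_metricAt g (contMDiffOn_chartSymmDeriv c _) (contMDiffOn_chartSymmDeriv c _)

/-- The coordinate expressions of an almost Hermitian structure in a chart. -/
lemma isHermitianOn_chart (hgJ : IsCompatible g J) (c : M) :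
    IsHermitianOn (gram g c) (jMatrix J c) (extChartAt (𝓡 n) c).target := by
  have hG : MatSmoothOn (gram g c) (extChartAt (𝓡 n) c).target := contDiffOn_gram g c
  have hdet : ∀ z ∈ (extChartAt (𝓡 n) c).target, 0 < (gram g c z).det :=
    fun z hz => (gram_posDef g hz).det_pos
  refine ⟨isOpen_target c, hG, ?_, fun z _ => ?_, hdet, fun z hz => ?_, fun z hz => ?_⟩
  -- The entries `g(∂ᵢ, J∂ⱼ)` of `G A` are smooth as pairings of smooth sections; multiplying by
  -- `G⁻¹` then gives smoothness of `A`.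
  · have h1 : MatSmoothOn (fun y => gram g c y * jMatrix J c y) (extChartAt (𝓡 n) c).target := by
      intro i j
      refine (contDiffOn_metricAt g (contMDiffOn_chartSymmDeriv c (EuclideanSpace.single i 1))
        (contMDiffOn_complexAt J (contMDiffOn_chartSymmDeriv c
          (EuclideanSpace.single j 1)))).congr fun y hy => ?_
      rw [complexAt_chartSymmDeriv J hy, metricAt_chartSymmDeriv, Matrix.mulVec_mulVec]
      simp
    have h2 := (hG.inv fun z hz => (hdet z hz).ne').mul h1
    intro i j
    refine (h2 i j).congr fun y hy => ?_
    beta_reduce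
    rw [← Matrix.mul_assoc, Matrix.nonsing_inv_mul _ (isUnit_iff_ne_zero.2 (hdet y hy).ne'),
      one_mul]
  · ext i j
    rw [Matrix.transpose_apply, gram_apply, gram_apply, metricAt_symm]
  · refine Matrix.ext_of_mulVec_single fun j => ?_
    have h1 := complexAt_sq J ((extChartAt (𝓡 n) c).symm z)
      (chartSymmDeriv c z (EuclideanSpace.single j 1))
    rw [complexAt_chartSymmDeriv J hz, complexAt_chartSymmDeriv J hz, ← map_neg] at h1
    have h2 := congrArg WithLp.ofLp (chartSymmDeriv_injective hz h1)
    rw [← Matrix.mulVec_mulVec, Matrix.neg_mulVec, Matrix.one_mulVec]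
    exact h2
  · have key (v w : EuclideanSpace ℝ (Fin n)) :
        dotProduct v (((jMatrix J c z).transpose * gram g c z * jMatrix J c z).mulVec w) =
          dotProduct v ((gram g c z).mulVec w) := by
      have h1 := hgJ ((extChartAt (𝓡 n) c).symm z) (chartSymmDeriv c z v) (chartSymmDeriv c z w)
      change metricAt g _ (complexAt J _ _) (complexAt J _ _) = metricAt g _ _ _ at h1
      rw [complexAt_chartSymmDeriv J hz, complexAt_chartSymmDeriv J hz, metricAt_chartSymmDeriv,
        metricAt_chartSymmDeriv] at h1
      rw [← h1, Matrix.mul_assoc, ← Matrix.mulVec_mulVec, Matrix.dotProduct_mulVec,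
        Matrix.vecMul_transpose, ← Matrix.mulVec_mulVec]
    ext i j
    have := key (EuclideanSpace.single i 1) (EuclideanSpace.single j 1)
    simpa using this

lemma contDiffOn_transition (c d : M) : ContDiffOn ℝ ∞ (transition c d) (overlap n c d) := by
  rw [← contMDiffOn_iff_contDiffOn]
  exact (contMDiffOn_extChartAt (I := 𝓡 n) (x := d)).comp
    ((contMDiffOn_symm c).mono Set.inter_subset_left) fun y hy => by
      simpa using hy.2

lemma fderiv_transition {c d : M} {y : EuclideanSpace ℝ (Fin n)} (hy : y ∈ overlap n c d)
    (v : EuclideanSpace ℝ (Fin n)) :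
    fderiv ℝ (transition c d) y v =
      chartDeriv d ((extChartAt (𝓡 n) c).symm y) (chartSymmDeriv c y v) := by
  have : IsManifold (𝓡 n) 1 M := .of_le (n := ∞) (by simp)
  have h2 : (extChartAt (𝓡 n) c).symm y ∈ (chartAt (EuclideanSpace ℝ (Fin n)) d).source := by
    simpa using hy.2
  have := mfderiv_comp y (mdifferentiableAt_extChartAt (I := 𝓡 n) h2)
    (mdifferentiableAt_symm hy.1)
  rw [← mfderiv_eq_fderiv]
  exact congrArg (fun f => f v) this

lemma chartSymmDeriv_fderiv_transition {c d : M} {y : EuclideanSpace ℝ (Fin n)}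
    (hy : y ∈ overlap n c d) (v : EuclideanSpace ℝ (Fin n)) :
    chartSymmDeriv d (transition c d y) (fderiv ℝ (transition c d) y v) = chartSymmDeriv c y v := by
  rw [fderiv_transition hy, ← symm_transition hy, chartSymmDeriv_chartDeriv
    (transition_mem_target hy)]

lemma fderiv_eq_jacobian_mulVec {Φ : EuclideanSpace ℝ (Fin n) → EuclideanSpace ℝ (Fin n)}
    {y : EuclideanSpace ℝ (Fin n)} (hΦ : DifferentiableAt ℝ Φ y) (v : EuclideanSpace ℝ (Fin n)) :
    fderiv ℝ Φ y v = WithLp.toLp 2 ((jacobian Φ y).mulVec v) := by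
  ext k
  have h1 : fderiv ℝ (fun z => Φ z k) y v = (fderiv ℝ Φ y v) k := by
    have := ((EuclideanSpace.proj (𝕜 := ℝ) k).hasFDerivAt.comp y hΦ.hasFDerivAt).fderiv
    rw [show (fun z => Φ z k) = (EuclideanSpace.proj (𝕜 := ℝ) k) ∘ Φ from rfl, this]
    rfl
  rw [← h1, fderiv_eq_sum_pderiv]
  exact Finset.sum_congr rfl fun i _ => mul_comm _ _

lemma chartSymmDeriv_jacobian {c d : M} {y : EuclideanSpace ℝ (Fin n)}
    (hy : y ∈ overlap n c d) (v : EuclideanSpace ℝ (Fin n)) :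
    chartSymmDeriv d (transition c d y) (WithLp.toLp 2 ((jacobian (transition c d) y).mulVec v)) =
      chartSymmDeriv c y v := by
  rw [← fderiv_eq_jacobian_mulVec, chartSymmDeriv_fderiv_transition hy]
  exact ((contDiffOn_transition c d).differentiableOn (by simp)).differentiableAt
    ((isOpen_overlap c d).mem_nhds hy)

lemma gram_eq_transition (g : RiemannianMetric n M) {c d : M} {y : EuclideanSpace ℝ (Fin n)}
    (hy : y ∈ overlap n c d) : gram g c y = (jacobian (transition c d) y).transpose *
      gram g d (transition c d y) * jacobian (transition c d) y := by
  have key (v w : EuclideanSpace ℝ (Fin n)) : dotProduct v ((gram g c y).mulVec w) =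
      dotProduct v (((jacobian (transition c d) y).transpose * gram g d (transition c d y) *
        jacobian (transition c d) y).mulVec w) := by
    rw [← metricAt_chartSymmDeriv, ← chartSymmDeriv_jacobian hy, ← chartSymmDeriv_jacobian hy,
      ← symm_transition hy, metricAt_chartSymmDeriv, Matrix.mul_assoc, ← Matrix.mulVec_mulVec,
      Matrix.dotProduct_mulVec _ (Matrix.transpose _), Matrix.vecMul_transpose,
      ← Matrix.mulVec_mulVec]
  ext i j
  have := key (EuclideanSpace.single i 1) (EuclideanSpace.single j 1)
  simpa using this

/-- Transition maps intertwine the coordinate expressions of an almost Hermitian structure. -/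
lemma isTransition_transition (g : RiemannianMetric n M) (J : AlmostComplexStructure n M) (c d : M) :
    IsTransition (transition c d) (gram g c) (jMatrix J c) (gram g d) (jMatrix J d)
      (overlap n c d) (extChartAt (𝓡 n) d).target := by
  refine ⟨contDiffOn_transition c d, fun y hy => transition_mem_target hy, fun y hy => ?_,
    fun y hy => gram_eq_transition g hy, fun y hy => ?_⟩
  · rw [← isUnit_iff_ne_zero, ← Matrix.isUnit_iff_isUnit_det, ← Matrix.mulVec_injective_iff_isUnit]
    intro v w hvw
    have h1 := chartSymmDeriv_jacobian hy (WithLp.toLp 2 v)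
    have h2 := chartSymmDeriv_jacobian hy (WithLp.toLp 2 w)
    simp only at h1 h2 hvw
    rw [hvw, h2] at h1
    simpa using (chartSymmDeriv_injective hy.1 h1).symm
  · refine Matrix.ext_of_mulVec_single fun j => ?_
    have h1 := complexAt_chartSymmDeriv J hy.1 (EuclideanSpace.single j 1)
    rw [← chartSymmDeriv_jacobian hy, ← chartSymmDeriv_jacobian hy, ← symm_transition hy,
      complexAt_chartSymmDeriv J (transition_mem_target hy)] at h1
    have h2 := congrArg WithLp.ofLp (chartSymmDeriv_injective (transition_mem_target hy) h1)
    rw [← Matrix.mulVec_mulVec, ← Matrix.mulVec_mulVec]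
    exact h2

end Charts

/-! ### Holomorphic coordinates force the Nijenhuis condition. -/

section Integrability

variable {n : ℕ}

/-- If `A` is multiplication by `i` in the coordinates `f`, then its Nijenhuis tensor vanishes. -/
lemma nijenhuisVanishes_of_fderiv {m : ℕ}
    {A : EuclideanSpace ℝ (Fin n) → Matrix (Fin n) (Fin n) ℝ}
    {U : Set (EuclideanSpace ℝ (Fin n))} {y : EuclideanSpace ℝ (Fin n)}
    {f : EuclideanSpace ℝ (Fin n) → Fin m → ℂ} (hU : IsOpen U) (hy : y ∈ U)
    (hA : MatSmoothOn A U) (hf : ContDiffOn ℝ ∞ f U)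
    (hfA : ∀ z ∈ U, ∀ v : EuclideanSpace ℝ (Fin n),
      fderiv ℝ f z (WithLp.toLp 2 ((A z).mulVec v)) = Complex.I • fderiv ℝ f z v)
    (hinj : Function.Injective (fderiv ℝ f y)) : NijenhuisVanishes A y := by
  set e : Fin n → EuclideanSpace ℝ (Fin n) := fun a => EuclideanSpace.single a 1
  set f₁ : Fin n → EuclideanSpace ℝ (Fin n) → Fin m → ℂ := fun b z => fderiv ℝ f z (e b) with hf₁
  set f₂ : Fin n → Fin n → Fin m → ℂ := fun a b => fderiv ℝ (f₁ b) y (e a) with hf₂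
  have hd : DifferentiableAt ℝ (fderiv ℝ f) y :=
    ((hf.fderiv_of_isOpen hU (m := ∞) (by simp)).differentiableOn (by simp)).differentiableAt
      (hU.mem_nhds hy)
  have hf₁d (b : Fin n) : DifferentiableAt ℝ (f₁ b) y := hd.clm_apply (by fun_prop)
  have hsymm (a b : Fin n) : f₂ a b = f₂ b a := by
    have h (k l : Fin n) : f₂ k l = fderiv ℝ (fderiv ℝ f) y (e k) (e l) := by
      simp only [hf₂, hf₁]
      rw [fderiv_clm_apply hd (by fun_prop)]
      simp
    rw [h, h]
    exact ((hf.contDiffAt (hU.mem_nhds hy)).isSymmSndFDerivAt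
      (by simpa using WithTop.coe_le_coe.2 (le_top (a := (2 : ℕ∞))))) _ _
  have hsum (v : Fin n → ℝ) (z : EuclideanSpace ℝ (Fin n)) :
      fderiv ℝ f z (WithLp.toLp 2 v) = ∑ c, v c • f₁ c z := by
    conv_lhs => rw [sum_single (WithLp.toLp 2 v)]
    simp [hf₁, e]
  have hrel (b : Fin n) (z : EuclideanSpace ℝ (Fin n)) (hz : z ∈ U) :
      ∑ c, A z c b • f₁ c z = Complex.I • f₁ b z := by
    rw [← hfA z hz (e b), hsum]
    refine Finset.sum_congr rfl fun c _ => ?_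
    simp [e]
  -- Differentiating `hrel`, that is `df ∘ A = i df`, expresses `df` of the derivatives of `A`
  -- through second derivatives of `f`.
  have hder (a b : Fin n) : ∑ c, matPderiv a A y c b • f₁ c y =
      Complex.I • f₂ a b - ∑ c, A y c b • f₂ a c := by
    have h1 : fderiv ℝ (fun z => ∑ c, A z c b • f₁ c z) y (e a) =
        ∑ c, (A y c b • f₂ a c + matPderiv a A y c b • f₁ c y) := by
      have hAd := hA.differentiableAt hU hy
      rw [fderiv_fun_sum fun c _ => (hAd c b).fun_smul (hf₁d c), _root_.sum_apply]
      refine Finset.sum_congr rfl fun c _ => ?_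
      rw [fderiv_fun_smul (hAd c b) (hf₁d c)]
      rfl
    have h2 : fderiv ℝ (fun z => ∑ c, A z c b • f₁ c z) y (e a) = Complex.I • f₂ a b := by
      rw [Filter.EventuallyEq.fderiv_eq (Filter.eventually_of_mem (hU.mem_nhds hy) (hrel b)),
        fderiv_fun_const_smul (hf₁d b)]
      rfl
    rw [← h2, h1, Finset.sum_add_distrib, add_sub_cancel_left]
  set N : Fin n → Fin n → Fin n → ℝ := fun a b c =>
    ∑ l, A y l a * matPderiv l A y c b - (A y * matPderiv a A y) c b with hN
  have e1 (a b : Fin n) : ∑ c, (∑ l, A y l a * matPderiv l A y c b) • f₁ c y =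
      Complex.I • ∑ l, A y l a • f₂ b l - ∑ l, ∑ c, (A y l a * A y c b) • f₂ l c := by
    simp only [Finset.sum_smul, mul_smul]
    rw [Finset.sum_comm]
    simp only [← Finset.smul_sum, hder, smul_sub, Finset.sum_sub_distrib]
    congr 1
    rw [Finset.smul_sum]
    refine Finset.sum_congr rfl fun l _ => ?_
    rw [hsymm l b, smul_comm]
  have e2 (a b : Fin n) : ∑ c, (A y * matPderiv a A y) c b • f₁ c y =
      -f₂ a b - Complex.I • ∑ l, A y l b • f₂ a l := by
    simp only [Matrix.mul_apply, Finset.sum_smul]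
    rw [Finset.sum_comm]
    have h3 (l : Fin n) : ∑ c, (A y c l * matPderiv a A y l b) • f₁ c y =
        Complex.I • (matPderiv a A y l b • f₁ l y) := by
      rw [smul_comm, ← hrel l y hy, Finset.smul_sum]
      exact Finset.sum_congr rfl fun c _ => by rw [smul_smul, mul_comm]
    simp only [h3, ← Finset.smul_sum, hder, smul_sub, smul_smul, Complex.I_mul_I, neg_smul, one_smul]
  have e3 (a b : Fin n) : ∑ l, ∑ c, (A y l a * A y c b) • f₂ l c =
      ∑ l, ∑ c, (A y l b * A y c a) • f₂ l c := by
    rw [Finset.sum_comm]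
    refine Finset.sum_congr rfl fun c _ => Finset.sum_congr rfl fun l _ => ?_
    rw [hsymm, mul_comm]
  -- In the expansion of `df(N a b)` all terms are symmetric in `a`, `b`, since second derivatives
  -- of `f` are symmetric. Injectivity of `df` transfers this to `N`.
  have hmain (a b : Fin n) : ∑ c, N a b c • f₁ c y = ∑ c, N b a c • f₁ c y := by
    simp only [hN, sub_smul, Finset.sum_sub_distrib, e1, e2]
    rw [e3 a b, hsymm a b]
    abel
  intro a b c
  have h4 : (WithLp.toLp 2 (N a b) : EuclideanSpace ℝ (Fin n)) = WithLp.toLp 2 (N b a) :=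
    hinj (by rw [hsum, hsum, hmain])
  exact congrFun (congrArg WithLp.ofLp h4) c

variable {M : Type*} [TopologicalSpace M] [ChartedSpace (EuclideanSpace ℝ (Fin n)) M]
  [IsManifold (𝓡 n) ∞ M]

/-- The holomorphic chart is read in the preferred chart at `c`. Only injectivity of its
differential matters, so `m` is never compared with `n`. -/
lemma AlmostComplexStructure.IsIntegrable.nijenhuisVanishes {g : RiemannianMetric n M}
    {J : AlmostComplexStructure n M} (hgJ : IsCompatible g J) (hJ : J.IsIntegrable) {c : M}
    {y : EuclideanSpace ℝ (Fin n)} (hy : y ∈ (extChartAt (𝓡 n) c).target) :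
    NijenhuisVanishes (jMatrix J c) y := by
  obtain ⟨m, φ, hx, hφ, hφs, hφJ⟩ := hJ ((extChartAt (𝓡 n) c).symm y)
  have : IsManifold (𝓡 n) 1 M := .of_le (n := ∞) (by simp)
  set U := (extChartAt (𝓡 n) c).target ∩ (extChartAt (𝓡 n) c).symm ⁻¹' φ.source with hU
  have hUo : IsOpen U := (continuousOn_extChartAt_symm c).isOpen_inter_preimage (isOpen_target c)
    φ.open_source
  have hmd : φ.MDifferentiable (𝓡 n) 𝓘(ℝ, Fin m → ℂ) :=
    ⟨hφ.mdifferentiableOn (by simp), hφs.mdifferentiableOn (by simp)⟩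
  have hf : ContDiffOn ℝ ∞ (fun z => φ ((extChartAt (𝓡 n) c).symm z)) U := by
    rw [← contMDiffOn_iff_contDiffOn]
    exact hφ.comp ((contMDiffOn_symm c).mono Set.inter_subset_left) fun z hz => hz.2
  have hder (z : EuclideanSpace ℝ (Fin n)) (hz : z ∈ U) (v : EuclideanSpace ℝ (Fin n)) :
      fderiv ℝ (fun z => φ ((extChartAt (𝓡 n) c).symm z)) z v =
        mfderiv (𝓡 n) 𝓘(ℝ, Fin m → ℂ) φ ((extChartAt (𝓡 n) c).symm z) (chartSymmDeriv c z v) := by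
    have := mfderiv_comp z (hmd.mdifferentiableAt hz.2) (mdifferentiableAt_symm hz.1)
    rw [← mfderiv_eq_fderiv]
    exact congrArg (fun f => f v) this
  refine nijenhuisVanishes_of_fderiv (m := m) hUo ⟨hy, hx⟩
    (((isHermitianOn_chart hgJ c).mono hUo Set.inter_subset_left).smooth_complex) hf
    (fun z hz v => ?_) fun v w hvw => ?_
  · rw [hder z hz, hder z hz, ← complexAt_chartSymmDeriv J hz.1]
    exact hφJ _ hz.2 _
  · rw [hder y ⟨hy, hx⟩, hder y ⟨hy, hx⟩] at hvw
    exact chartSymmDeriv_injective hy (hmd.mfderiv_injective hx hvw)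

end Integrability

/-! ### The divergence theorem inside a coordinate domain. -/

section EuclideanDivergence

variable {n : ℕ}

lemma integral_pderiv_eq_zero {f : EuclideanSpace ℝ (Fin n) → ℝ} (hf : ContDiff ℝ ∞ f)
    (hfc : HasCompactSupport f) (k : Fin n) :
    Integrable (pderiv k f) ∧ ∫ y, pderiv k f y = 0 := by
  have hd : Continuous (pderiv k f) := (hf.continuous_fderiv (by simp)).clm_apply continuous_const
  have hi : Integrable (pderiv k f) := hd.integrable_of_hasCompactSupport
    (hfc.fderiv_apply (𝕜 := ℝ) (EuclideanSpace.single k 1))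
  refine ⟨hi, ?_⟩
  -- Integration by parts against the constant function `1`.
  have := integral_mul_fderiv_eq_neg_fderiv_mul_of_integrable (μ := volume) (𝕜 := ℝ)
    (f := fun _ : EuclideanSpace ℝ (Fin n) => (1 : ℝ)) (g := f) (v := EuclideanSpace.single k 1)
    (by simp) (by simp only [one_mul]; exact hi)
    (by simpa using hf.continuous.integrable_of_hasCompactSupport hfc)
    (fun _ _ => differentiableAt_const _) (fun _ _ => hf.differentiable (by simp) _)
  simpa [pderiv] using this

/-- The divergence theorem for compactly supported vector fields in a coordinate domain. -/
lemma IsHermitianOn.integral_divergence_eq_zero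
    {G A : EuclideanSpace ℝ (Fin n) → Matrix (Fin n) (Fin n) ℝ}
    {U K : Set (EuclideanSpace ℝ (Fin n))} (h : IsHermitianOn G A U)
    {X : EuclideanSpace ℝ (Fin n) → Fin n → ℝ} (hX : ∀ k, ContDiffOn ℝ ∞ (fun z => X z k) U)
    (hK : IsCompact K) (hKU : K ⊆ U) (hXK : ∀ z ∈ U, z ∉ K → X z = 0) :
    IntegrableOn (fun y => density G y * divergence (density G) X y) U ∧
      ∫ y in U, density G y * divergence (density G) X y = 0 := by
  -- The product `ρ Xᵏ` extended by zero is smooth on the whole space because it vanishes off the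
  -- compact `K`; the weight `ρ` in the integral cancels the division by `ρ` in the divergence.
  set Y : Fin n → EuclideanSpace ℝ (Fin n) → ℝ :=
    fun k => U.indicator fun z => density G z * X z k with hY
  have hYU (k : Fin n) (y) (hy : y ∈ U) : Y k =ᶠ[nhds y] fun z => density G z * X z k :=
    Filter.eventually_of_mem (h.isOpen.mem_nhds hy) fun z hz => Set.indicator_of_mem hz _
  have hY0 (k : Fin n) (y) (hy : y ∉ K) : Y k y = 0 := by
    by_cases hyU : y ∈ U
    · simp [hY, hyU, hXK y hyU hy]
    · simp [hY, hyU]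
  have hYK (k : Fin n) (y) (hy : y ∉ K) : Y k =ᶠ[nhds y] fun _ => 0 :=
    Filter.eventually_of_mem (hK.isClosed.isOpen_compl.mem_nhds hy) fun z hz => hY0 k z hz
  have hYs (k : Fin n) : ContDiff ℝ ∞ (Y k) := by
    rw [contDiff_iff_contDiffAt]
    intro y
    by_cases hy : y ∈ K
    · exact ((h.smooth_density.mul (hX k)).contDiffAt (h.isOpen.mem_nhds (hKU hy))).congr_of_eventuallyEq
        (hYU k y (hKU hy))
    · exact contDiffAt_const.congr_of_eventuallyEq (hYK k y hy)
  have hint (k : Fin n) := integral_pderiv_eq_zero (hYs k) (HasCompactSupport.intro hK (hY0 k)) k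
  have heq : Set.EqOn (fun y => ∑ k, pderiv k (Y k) y)
      (fun y => density G y * divergence (density G) X y) U := fun y hy => by
    beta_reduce
    rw [divergence, mul_div_cancel₀ _ (h.density_pos hy).ne']
    exact Finset.sum_congr rfl fun k _ => pderiv_congr (hYU k y hy)
  have hsum : Integrable fun y => ∑ k, pderiv k (Y k) y := integrable_finsetSum _ fun k _ => (hint k).1
  refine ⟨hsum.integrableOn.congr_fun heq h.isOpen.measurableSet, ?_⟩
  rw [← setIntegral_congr_fun h.isOpen.measurableSet heq,
    setIntegral_eq_integral_of_forall_compl_eq_zero, integral_finsetSum _ fun k _ => (hint k).1]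
  · exact Finset.sum_eq_zero fun k _ => (hint k).2
  · intro y hy
    refine Finset.sum_eq_zero fun k _ => ?_
    rw [pderiv_congr (hYK k y fun hyK => hy (hKU hyK)), pderiv_const]

lemma det_fderiv {Φ : EuclideanSpace ℝ (Fin n) → EuclideanSpace ℝ (Fin n)}
    {y : EuclideanSpace ℝ (Fin n)} (hΦ : DifferentiableAt ℝ Φ y) :
    (fderiv ℝ Φ y).det = (jacobian Φ y).det := by
  rw [ContinuousLinearMap.det, ← LinearMap.det_toMatrix (EuclideanSpace.basisFun (Fin n) ℝ).toBasis]
  congr 1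
  ext i j
  rw [LinearMap.toMatrix_apply]
  simp [fderiv_eq_jacobian_mulVec hΦ]

end EuclideanDivergence

/-! ### The Riemannian measure and integration in charts. -/

section Volume

variable {n : ℕ} {M : Type*} [TopologicalSpace M] [ChartedSpace (EuclideanSpace ℝ (Fin n)) M]
  [MeasurableSpace M] [BorelSpace M]

lemma aemeasurable_symm (c : M) : AEMeasurable (extChartAt (𝓡 n) c).symm
    ((volume : Measure (EuclideanSpace ℝ (Fin n))).restrict (extChartAt (𝓡 n) c).target) :=
  (continuousOn_extChartAt_symm c).aemeasurable (isOpen_target c).measurableSet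

/-- The inverse chart is controlled only on its target, so it is replaced outside by a constant to
obtain a globally measurable map. -/
lemma measurableSet_target_inter (c : M) {s : Set M} (hs : MeasurableSet s) :
    MeasurableSet ((extChartAt (𝓡 n) c).target ∩ (extChartAt (𝓡 n) c).symm ⁻¹' s) := by
  classical
  have h1 : Measurable ((extChartAt (𝓡 n) c).target.piecewise (extChartAt (𝓡 n) c).symm
      fun _ => c) := (continuousOn_extChartAt_symm c).measurable_piecewise continuousOn_const
    (isOpen_target c).measurableSet
  have h2 := (isOpen_target (n := n) c).measurableSet.inter (h1 hs)
  convert h2 using 1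
  ext y
  simp only [Set.mem_inter_iff, Set.mem_preimage]
  refine and_congr_right fun hy => ?_
  rw [Set.piecewise_eq_of_mem _ _ _ hy]

lemma measurableSet_source (c : M) : MeasurableSet (extChartAt (𝓡 n) c).source :=
  (isOpen_extChartAt_source c).measurableSet

variable [IsManifold (𝓡 n) ∞ M]

omit [MeasurableSpace M] [BorelSpace M] in
lemma aemeasurable_density (g : RiemannianMetric n M) (c : M) :
    AEMeasurable (fun y => ENNReal.ofReal (density (gram g c) y))
      ((volume : Measure (EuclideanSpace ℝ (Fin n))).restrict (extChartAt (𝓡 n) c).target) :=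
  (((contDiffOn_gram g c).det.continuousOn.sqrt).aemeasurable
    (isOpen_target c).measurableSet).ennreal_ofReal

lemma chartVolume_apply (g : RiemannianMetric n M) (c : M) {s : Set M} (hs : MeasurableSet s) :
    chartVolume g c s = ∫⁻ y in (extChartAt (𝓡 n) c).target ∩ (extChartAt (𝓡 n) c).symm ⁻¹' s,
      ENNReal.ofReal (density (gram g c) y) := by
  rw [chartVolume, Measure.map_apply_of_aemeasurable
    ((aemeasurable_symm c).mono_ac (withDensity_absolutelyContinuous _ _)) hs, withDensity_apply',
    Measure.restrict_restrict' (isOpen_target c).measurableSet, Set.inter_comm]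
  rfl

lemma chartVolume_inter_source (g : RiemannianMetric n M) (c : M) {s : Set M}
    (hs : MeasurableSet s) :
    chartVolume g c (s ∩ (extChartAt (𝓡 n) c).source) = chartVolume g c s := by
  rw [chartVolume_apply g c hs, chartVolume_apply g c (hs.inter (measurableSet_source c))]
  congr 2
  ext y
  simp only [Set.mem_inter_iff, Set.mem_preimage, and_congr_right_iff, and_iff_left_iff_imp]
  exact fun hy _ => (extChartAt (𝓡 n) c).map_target hy

/-- The volumes of two chart domains agree on their intersection. -/
lemma chartVolume_eq_chartVolume (g : RiemannianMetric n M) (c d : M) {s : Set M}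
    (hs : MeasurableSet s) (hsc : s ⊆ (extChartAt (𝓡 n) c).source)
    (hsd : s ⊆ (extChartAt (𝓡 n) d).source) : chartVolume g c s = chartVolume g d s := by
  set B := (extChartAt (𝓡 n) c).target ∩ (extChartAt (𝓡 n) c).symm ⁻¹' s with hB
  have hBo : B ⊆ overlap n c d := fun y hy => ⟨hy.1, hsd hy.2⟩
  have himg : (extChartAt (𝓡 n) d).target ∩ (extChartAt (𝓡 n) d).symm ⁻¹' s =
      transition c d '' B := by
    ext z
    constructor
    · rintro ⟨hz, hzs⟩
      have hz' : z ∈ overlap n d c := ⟨hz, hsc hzs⟩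
      exact ⟨transition d c z, ⟨transition_mem_target hz', by
        rw [Set.mem_preimage, symm_transition hz']; exact hzs⟩, transition_transition hz'⟩
    · rintro ⟨y, hy, rfl⟩
      exact ⟨transition_mem_target (hBo hy), by
        rw [Set.mem_preimage, symm_transition (hBo hy)]; exact hy.2⟩
  have hΦ (y) (hy : y ∈ B) : DifferentiableAt ℝ (transition c d) y :=
    ((contDiffOn_transition c d).differentiableOn (by simp)).differentiableAt
      ((isOpen_overlap c d).mem_nhds (hBo hy))
  have hinj : Set.InjOn (transition (n := n) c d) B := fun y hy z hz hyz => by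
    rw [← transition_transition (hBo hy), hyz, transition_transition (hBo hz)]
  have hBm : MeasurableSet B := measurableSet_target_inter c hs
  rw [chartVolume_apply g c hs, chartVolume_apply g d hs, himg,
    lintegral_image_eq_lintegral_abs_det_fderiv_mul volume hBm
      (fun y hy => (hΦ y hy).hasFDerivAt.hasFDerivWithinAt) hinj]
  refine setLIntegral_congr_fun hBm fun y hy => ?_
  beta_reduce
  rw [det_fderiv (hΦ y hy), ← ENNReal.ofReal_mul (abs_nonneg _), density,
    sqrt_det_transpose_mul_mul (gram_eq_transition g (hBo hy))]
  rfl

/-- The Riemannian volume measure restricts to the volume of each chart domain. -/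
lemma volumeMeasure_restrict (g : RiemannianMetric n M) (c : M) :
    (volumeMeasure g).restrict (extChartAt (𝓡 n) c).source = chartVolume g c := by
  have hc := measurableSet_source (n := n) c
  refine le_antisymm ?_ ?_
  -- Every chart volume agrees with that of `c` on the common domain, and off the source of `c` it
  -- is bounded crudely by the measure `⊤`. The bound passes to the supremum, and restriction to the
  -- source removes the `⊤` part.
  · have hle : volumeMeasure g ≤
        chartVolume g c + (⊤ : Measure M).restrict (extChartAt (𝓡 n) c).sourceᶜ := by
      refine iSup_le fun d => Measure.le_iff.2 fun s hs => ?_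
      rw [← measure_inter_add_sdiff s hc, Measure.add_apply, Measure.restrict_apply hs]
      refine add_le_add ?_ (le_top (a := chartVolume g d) _)
      have hsc := hs.inter hc
      rw [← chartVolume_inter_source g d hsc, ← chartVolume_eq_chartVolume g c d
        (hsc.inter (measurableSet_source d)) (fun x hx => hx.1.2) (fun x hx => hx.2)]
      exact measure_mono fun x hx => hx.1.1
    refine (Measure.restrict_mono le_rfl hle).trans ?_
    rw [Measure.restrict_add, Measure.restrict_restrict hc]
    simp [Measure.restrict_le_self]
  · refine Measure.le_iff.2 fun s hs => ?_
    rw [Measure.restrict_apply hs, ← chartVolume_inter_source g c hs]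
    exact le_iSup (chartVolume g) c _

/-- Integrals of functions supported in a chart domain are computed in coordinates. -/
lemma integral_volumeMeasure (g : RiemannianMetric n M) (c : M) {F : M → ℝ} (hF : Continuous F)
    (hF0 : ∀ x, x ∉ (extChartAt (𝓡 n) c).source → F x = 0) :
    (IntegrableOn (fun y => density (gram g c) y * F ((extChartAt (𝓡 n) c).symm y))
      (extChartAt (𝓡 n) c).target → Integrable F (volumeMeasure g)) ∧
    ∫ x, F x ∂(volumeMeasure g) = ∫ y in (extChartAt (𝓡 n) c).target,
      density (gram g c) y * F ((extChartAt (𝓡 n) c).symm y) := by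
  have hm := (aemeasurable_symm (n := n) c).mono_ac
    (withDensity_absolutelyContinuous _ fun y => ENNReal.ofReal (density (gram g c) y))
  have hρ := aemeasurable_density g c
  have htop : ∀ᵐ y ∂((volume : Measure (EuclideanSpace ℝ (Fin n))).restrict
    (extChartAt (𝓡 n) c).target), ENNReal.ofReal (density (gram g c) y) < ⊤ :=
    Filter.Eventually.of_forall fun y => ENNReal.ofReal_lt_top
  have hreal (y) : (ENNReal.ofReal (density (gram g c) y)).toReal = density (gram g c) y :=
    ENNReal.toReal_ofReal (Real.sqrt_nonneg _)
  constructor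
  · intro hi
    rw [← integrableOn_iff_integrable_of_support_subset (s := (extChartAt (𝓡 n) c).source)
      (fun x hx => by_contra fun h => hx (hF0 x h)), IntegrableOn, volumeMeasure_restrict]
    refine (integrable_map_measure hF.aestronglyMeasurable hm).2 ?_
    refine (integrable_withDensity_iff_integrable_smul₀' hρ htop).2 ?_
    simp only [hreal, smul_eq_mul]
    exact hi
  · rw [← setIntegral_eq_integral_of_forall_compl_eq_zero hF0, volumeMeasure_restrict]
    refine (integral_map hm hF.aestronglyMeasurable).trans ?_
    refine (integral_withDensity_eq_integral_toReal_smul₀ hρ htop _).trans ?_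
    simp only [hreal, smul_eq_mul]

end Volume

/-! ### The divergence theorem on `M` and the sign of the total curvature. -/

section GlobalDivergence

variable {n : ℕ} {M : Type*} [TopologicalSpace M] [ChartedSpace (EuclideanSpace ℝ (Fin n)) M]
  [IsManifold (𝓡 n) ∞ M] {g : RiemannianMetric n M} {J : AlmostComplexStructure n M}

/-- The divergence of the product of a function with the Lee vector field, as a function on `M`. -/
def leeDivergence (g : RiemannianMetric n M) (J : AlmostComplexStructure n M) (ψ : M → ℝ)
    (x : M) : ℝ :=
  divergence (density (gram g x)) (fun z k => ψ ((extChartAt (𝓡 n) x).symm z) *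
    leeField (gram g x) (jMatrix J x) z k) (extChartAt (𝓡 n) x x)

lemma contDiffOn_comp_symm {ψ : M → ℝ} (hψ : ContMDiff (𝓡 n) 𝓘(ℝ) ∞ ψ) (c : M) :
    ContDiffOn ℝ ∞ (fun z => ψ ((extChartAt (𝓡 n) c).symm z)) (extChartAt (𝓡 n) c).target := by
  rw [← contMDiffOn_iff_contDiffOn]
  exact hψ.comp_contMDiffOn (contMDiffOn_symm c)

/-- The divergence may be computed in any chart. -/
lemma leeDivergence_eq (hgJ : IsCompatible g J) {ψ : M → ℝ} (hψ : ContMDiff (𝓡 n) 𝓘(ℝ) ∞ ψ)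
    {c x : M} (hx : x ∈ (extChartAt (𝓡 n) c).source) :
    leeDivergence g J ψ x = divergence (density (gram g c)) (fun z k =>
      ψ ((extChartAt (𝓡 n) c).symm z) * leeField (gram g c) (jMatrix J c) z k)
        (extChartAt (𝓡 n) c x) := by
  have hxx : (extChartAt (𝓡 n) x).symm (extChartAt (𝓡 n) x x) = x := extChartAt_to_inv x
  have hy : extChartAt (𝓡 n) x x ∈ overlap n x c :=
    ⟨mem_extChartAt_target x, by rw [Set.mem_preimage, hxx]; exact hx⟩
  have key := (isTransition_transition g J x c).divergence_smul_leeField_eq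
    ((isHermitianOn_chart hgJ x).mono (isOpen_overlap x c) Set.inter_subset_left)
    (isHermitianOn_chart hgJ c) hy ((contDiffOn_comp_symm hψ x).mono Set.inter_subset_left)
    (contDiffOn_comp_symm hψ c) fun z hz => by rw [symm_transition hz]
  rw [leeDivergence, ← key, transition, hxx]

lemma leeDivergence_eq_zero {ψ : M → ℝ} {x : M} (hx : x ∉ tsupport ψ) :
    leeDivergence g J ψ x = 0 := by
  have h1 : ∀ᶠ z in nhds (extChartAt (𝓡 n) x x), ψ ((extChartAt (𝓡 n) x).symm z) = 0 := by
    have hc : ContinuousAt (extChartAt (𝓡 n) x).symm (extChartAt (𝓡 n) x x) :=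
      continuousAt_extChartAt_symm x
    have ho : (tsupport ψ)ᶜ ∈ nhds ((extChartAt (𝓡 n) x).symm (extChartAt (𝓡 n) x x)) := by
      rw [extChartAt_to_inv]
      exact (isClosed_tsupport ψ).isOpen_compl.mem_nhds hx
    filter_upwards [hc.preimage_mem_nhds ho] with z hz using image_eq_zero_of_notMem_tsupport hz
  rw [leeDivergence, divergence_congr (Y := fun _ _ => 0)
    (h1.mono fun z hz => by funext k; exact mul_eq_zero_of_left hz _)]
  simp [divergence, pderiv_const]

lemma contDiffOn_smul_leeField (hgJ : IsCompatible g J) {ψ : M → ℝ}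
    (hψ : ContMDiff (𝓡 n) 𝓘(ℝ) ∞ ψ) (c : M) (k : Fin n) :
    ContDiffOn ℝ ∞ (fun z => ψ ((extChartAt (𝓡 n) c).symm z) *
      leeField (gram g c) (jMatrix J c) z k) (extChartAt (𝓡 n) c).target :=
  (contDiffOn_comp_symm hψ c).mul ((isHermitianOn_chart hgJ c).contDiffOn_leeField k)

/-- The definition uses a different chart at each point; continuity at `c` becomes visible once
nearby values are computed in the single chart at `c`. -/
lemma continuous_leeDivergence (hgJ : IsCompatible g J) {ψ : M → ℝ}
    (hψ : ContMDiff (𝓡 n) 𝓘(ℝ) ∞ ψ) : Continuous (leeDivergence g J ψ) := by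
  refine continuous_iff_continuousAt.2 fun c => ?_
  have h1 := ((isHermitianOn_chart hgJ c).contDiffOn_divergence fun k =>
    contDiffOn_smul_leeField hgJ hψ c k).continuousOn.continuousAt
      ((isOpen_target c).mem_nhds (mem_extChartAt_target c))
  refine (h1.comp (continuousAt_extChartAt c)).congr ?_
  filter_upwards [extChartAt_source_mem_nhds (I := 𝓡 n) c] with x hx
  exact (leeDivergence_eq hgJ hψ hx).symm

variable [MeasurableSpace M] [BorelSpace M]

/-- The divergence theorem for vector fields supported in a chart domain. -/
lemma integral_leeDivergence_of_tsupport_subset [CompactSpace M] (hgJ : IsCompatible g J)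
    {ψ : M → ℝ} (hψ : ContMDiff (𝓡 n) 𝓘(ℝ) ∞ ψ) {c : M}
    (hc : tsupport ψ ⊆ (extChartAt (𝓡 n) c).source) :
    Integrable (leeDivergence g J ψ) (volumeMeasure g) ∧
      ∫ x, leeDivergence g J ψ x ∂(volumeMeasure g) = 0 := by
  set K := extChartAt (𝓡 n) c '' tsupport ψ with hKdef
  have hK : IsCompact K := (isClosed_tsupport ψ).isCompact.image_of_continuousOn
    ((continuousOn_extChartAt c).mono hc)
  have hKU : K ⊆ (extChartAt (𝓡 n) c).target := by
    rintro _ ⟨x, hx, rfl⟩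
    exact (extChartAt (𝓡 n) c).map_source (hc hx)
  obtain ⟨hi, h0⟩ := (isHermitianOn_chart hgJ c).integral_divergence_eq_zero
    (fun k => contDiffOn_smul_leeField hgJ hψ c k) hK hKU fun z hz hzK => by
      have : (extChartAt (𝓡 n) c).symm z ∉ tsupport ψ := fun h =>
        hzK ⟨_, h, (extChartAt (𝓡 n) c).right_inv hz⟩
      funext k
      exact mul_eq_zero_of_left (image_eq_zero_of_notMem_tsupport this) _
  obtain ⟨h1, h2⟩ := integral_volumeMeasure g c (continuous_leeDivergence hgJ hψ)
    fun x hx => leeDivergence_eq_zero fun h => hx (hc h)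
  have heq : Set.EqOn (fun y => density (gram g c) y * divergence (density (gram g c)) (fun z k =>
      ψ ((extChartAt (𝓡 n) c).symm z) * leeField (gram g c) (jMatrix J c) z k) y)
      (fun y => density (gram g c) y * leeDivergence g J ψ ((extChartAt (𝓡 n) c).symm y))
      (extChartAt (𝓡 n) c).target := fun y hy => by
    beta_reduce
    rw [leeDivergence_eq hgJ hψ ((extChartAt (𝓡 n) c).map_target hy),
      (extChartAt (𝓡 n) c).right_inv hy]
  have hm := (isOpen_target (n := n) c).measurableSet
  exact ⟨h1 (hi.congr_fun heq hm), by rw [h2, ← setIntegral_congr_fun hm heq, h0]⟩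

/-- The divergence theorem for the Lee field on a closed manifold. -/
lemma integral_leeDivergence_one [T2Space M] [CompactSpace M] (hgJ : IsCompatible g J) :
    Integrable (leeDivergence g J fun _ => 1) (volumeMeasure g) ∧
      ∫ x, leeDivergence g J (fun _ => 1) x ∂(volumeMeasure g) = 0 := by
  obtain ⟨t, ht⟩ := isCompact_univ.elim_finite_subcover
    (fun c : M => (extChartAt (𝓡 n) c).source) isOpen_extChartAt_source
    fun x _ => Set.mem_iUnion.2 ⟨x, mem_extChartAt_source x⟩
  obtain ⟨f, hf⟩ := SmoothPartitionOfUnity.exists_isSubordinate (𝓡 n) isClosed_univ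
    (fun c : t => (extChartAt (𝓡 n) (c : M)).source) (fun c => isOpen_extChartAt_source _)
    (by simpa [Set.iUnion_subtype] using ht)
  have hsum (x : M) : ∑ c, f c x = 1 := by
    rw [← finsum_eq_sum_of_fintype]; exact f.sum_eq_one (Set.mem_univ x)
  -- Divergence is additive and `V = ∑ f_c V`. Compactness makes the partition of unity finite, so
  -- sum and integral may be exchanged.
  have heq : (leeDivergence g J fun _ => 1) = fun x => ∑ c, leeDivergence g J (f c) x := by
    funext x
    have hx := mem_extChartAt_target (I := 𝓡 n) x
    have h := isHermitianOn_chart hgJ x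
    unfold leeDivergence
    rw [← divergence_sum (differentiableAt_of_contDiffOn h.isOpen h.smooth_density hx)
      fun c _ k => differentiableAt_of_contDiffOn h.isOpen
        (contDiffOn_smul_leeField hgJ (f c).contMDiff x k) hx]
    simp only [← Finset.sum_mul, hsum]
  have hint (c : t) := integral_leeDivergence_of_tsupport_subset hgJ (f c).contMDiff (hf c)
  rw [heq]
  refine ⟨integrable_finsetSum _ fun c _ => (hint c).1, ?_⟩
  rw [integral_finsetSum _ fun c _ => (hint c).1]
  exact Finset.sum_eq_zero fun c _ => (hint c).2

-- The number `q` is `|δJ|²` at `x`, nonnegative because the metric is positive definite. Curvature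
-- and divergence are both evaluated in the preferred chart at `x`, so the local identity applies
-- without a change of coordinates.
omit [MeasurableSpace M] [BorelSpace M] in
lemma holoScalarCurvature_eq (hgJ : IsCompatible g J) (hJ : J.IsIntegrable) (x : M) :
    ∃ q : ℝ, 0 ≤ q ∧ holoScalarCurvature g J x = 2 * leeDivergence g J (fun _ => 1) x + q := by
  have hx := mem_extChartAt_target (I := 𝓡 n) x
  set y := extChartAt (𝓡 n) x x
  refine ⟨dotProduct (divJ (gram g x) (jMatrix J x) y)
    ((gram g x y).mulVec (divJ (gram g x) (jMatrix J x) y)), ?_, ?_⟩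
  · simpa using (gram_posDef g hx).posSemidef.dotProduct_mulVec_nonneg
      (divJ (gram g x) (jMatrix J x) y)
  · rw [leeDivergence]
    simp only [one_mul]
    exact (isHermitianOn_chart hgJ x).scalar_sub_starScalar_eq hx (hJ.nijenhuisVanishes hgJ hx)

/-- The total holomorphic d-scalar curvature of a closed Hermitian manifold is nonnegative. -/
theorem integral_holoScalarCurvature_nonneg [T2Space M] [CompactSpace M] (hgJ : IsCompatible g J)
    (hJ : J.IsIntegrable) : 0 ≤ ∫ x, holoScalarCurvature g J x ∂(volumeMeasure g) := by
  -- If `S_J` were not integrable, its integral would be `0` by convention, which also satisfies the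
  -- bound.
  by_cases hS : Integrable (holoScalarCurvature g J) (volumeMeasure g)
  · obtain ⟨hi, h0⟩ := integral_leeDivergence_one hgJ
    rw [← mul_zero (2 : ℝ), ← h0, ← integral_const_mul]
    refine integral_mono (hi.const_mul 2) hS fun x => ?_
    obtain ⟨q, hq, hx⟩ := holoScalarCurvature_eq hgJ hJ x
    rw [hx]
    exact le_add_of_nonneg_right hq
  · rw [integral_undef hS]

omit [MeasurableSpace M] [BorelSpace M] in
lemma isCompatible_conformalMetric (hgJ : IsCompatible g J) (u : PosSmooth n M) :
    IsCompatible (conformalMetric g u) J := fun x v w =>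
  congrArg (u.toFun x ^ (critExp n - 2) * ·) (hgJ x v w)

end GlobalDivergence

end AlmostHermitian

end

theorem mainTheorem5 (n : ℕ) (hn : 6 ≤ n) (M : Type*) [TopologicalSpace M] [T2Space M]
    [CompactSpace M] [ConnectedSpace M] [ChartedSpace (EuclideanSpace ℝ (Fin n)) M]
    [IsManifold (𝓡 n) ∞ M] [MeasurableSpace M] [BorelSpace M]
    (g : AlmostHermitian.RiemannianMetric n M) (J : AlmostHermitian.AlmostComplexStructure n M)
    (hgJ : AlmostHermitian.IsCompatible g J)
    (hY : AlmostHermitian.yamabeInvariant g J < 0) :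
    ¬ J.IsIntegrable := by
  intro hJ
  refine hY.not_ge (le_iInf fun u => ?_)
  -- Nonnegativity of the denominator suffices, so the volume need not be shown positive or finite.
  exact_mod_cast div_nonneg (AlmostHermitian.integral_holoScalarCurvature_nonneg
    (AlmostHermitian.isCompatible_conformalMetric hgJ u) hJ)
    (Real.rpow_nonneg measureReal_nonneg _)
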